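/- Let $T>0$, let $f_0:\mathbb R^d\to\mathbb R^d$, $f:\mathbb R^d\to\mathbb R^{d\times m}$ and $c:\mathbb R^d\to\mathbb R^p$ be Lipschitz continuous on every ball, let $x_0\in\mathbb R^d$, and suppose that there is a constant $\mathcal C$ with $$2\langle x,f_0(x)\rangle+\|f(x)\|_F^2\le \mathcal C\,(1+\|x\|^2)\qquad\text{for all }x\in\mathbb R^d,$$ where $\|\cdot\|_F$ is the Frobenius norm. Then for every control $u\in L^2([0,T];\mathbb R^m)$ the equation $$\dot x(t)=f_0(x(t))+f(x(t))u(t),\qquad x(0)=x_0,$$ has exactly one (Carathéodory) solution $x(\cdot;u)$ on $[0,T]$. Put $y(t;u)=c(x(t;u))$ and $\hat U(t)=\big(t,\int_0^t u(s)^\top\,\mathrm ds\big)^\top\in\mathbb R^{m+1}$, and let $$S^N_{0,t}(\hat U)=\big(1,\hat U^{(1)}_{0,t},\dots,\hat U^{(N)}_{0,t}\big)\in\mathbb R^{n},\qquad n=\sum_{k=0}^N(m+1)^k,$$ be the truncated signature of order $N$, where $$\hat U^{(k)}_{0,t}=\int\!\cdots\!\int_{0<s_1<\dots<s_k<t}\mathrm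 d\hat U(s_1)\otimes\cdots\otimes\mathrm d\hat U(s_k)\in\mathbb R^{(m+1)^k}$$ are the iterated (Riemann–Stieltjes) integrals. The entries of $S^N_{0,t}(\hat U)$ are indexed by the words of length at most $N$ over the alphabet $\{0,1,\dots,m\}$. 1. Let $\mathcal K\subset L^2([0,T];\mathbb R^m)$ be compact. For every $\varepsilon>0$ there are an order $N\in\mathbb N$ and a matrix $C\in\mathbb R^{p\times n}$, independent of $t$ and $u$, such that $$\sup_{t\in[0,T]}\ \sup_{u\in\mathcal K}\ \big\|y(t;u)-C\,S^N_{0,t}(\hat U)\big\|<\varepsilon .$$ 2. For every $N\in\mathbb N$ and every $u\in L^2([0,T];\mathbb R^m)$, $S(t)=S^N_{0,t}(\hat U)$ solves on $[0,T]$ the bilinear system $$\dot S(t)=A_0S(t)+\sum_{i=1}^m A_iS(t)\,u_i(t),\qquad S(0)=\mathbf e_1,$$ where $\mathbf e_1$ is the unit vector of the empty word and $A_i\in\mathbb R^{n\times n}$ maps the unit vector of a word $v$ of length less than $N$ to the unit vector of the word $vi$, and the unit vector of a word of length $N$ to $0$. (These matrices do not depend on $f_0,f,c,x_0$.) -/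

import Mathlib

open MeasureTheory Set
open scoped ENNReal

/- Matrices carry the Frobenius norm. -/
attribute [local instance] Matrix.frobeniusNormedAddCommGroup

/-- `g` is Lipschitz continuous on every ball around the origin. -/
def LipschitzOnBalls {E F : Type*} [NormedAddCommGroup E] [NormedAddCommGroup F]
    (g : E → F) : Prop :=
  ∀ R : ℝ, 0 < R → ∃ L : ℝ, 0 < L ∧
    ∀ x z : E, ‖x‖ ≤ R → ‖z‖ ≤ R → ‖g x - g z‖ ≤ L * ‖x - z‖

/-- The space `L²([0,T]; ℝᵐ)` of controls. -/
abbrev Control (T : ℝ) (m : ℕ) : Type :=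
  Lp (EuclideanSpace ℝ (Fin m)) 2 (volume.restrict (Icc (0 : ℝ) T))

/-- `x` is a (global, Carathéodory) solution on `[0,T]` of `ẋ(t) = F t (x t)`, `x 0 = x₀`: it is
continuous and satisfies the integrated equation, whose integrand is integrable (equivalently,
`x` is absolutely continuous, starts in `x₀` and satisfies the equation for almost every `t`).
Only the values of `x` on `[0,T]` matter. -/
def IsSolutionOn {E : Type*} [NormedAddCommGroup E] [NormedSpace ℝ E]
    (T : ℝ) (F : ℝ → E → E) (x₀ : E) (x : ℝ → E) : Prop :=
  ContinuousOn x (Icc 0 T) ∧ ∀ t ∈ Icc 0 T,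
    IntervalIntegrable (fun s => F s (x s)) volume 0 t ∧
      x t = x₀ + ∫ s in (0 : ℝ)..t, F s (x s)

/-- The right-hand side `f₀(x) + f(x) u(t)` of the controlled differential equation. -/
noncomputable def controlledField {d m : ℕ}
    (f₀ : EuclideanSpace ℝ (Fin d) → EuclideanSpace ℝ (Fin d))
    (f : EuclideanSpace ℝ (Fin d) → Matrix (Fin d) (Fin m) ℝ)
    (u : ℝ → EuclideanSpace ℝ (Fin m)) (t : ℝ) (x : EuclideanSpace ℝ (Fin d)) :
    EuclideanSpace ℝ (Fin d) :=
  f₀ x + (f x).toEuclideanLin (u t)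

/-- `I` is the Riemann–Stieltjes integral `∫_a^b f dg` (for `a ≤ b`): the limit of the sums
`∑ f(ξᵢ) (g(tᵢ₊₁) - g(tᵢ))` over tagged partitions `a = t₀ ≤ ξ₀ ≤ t₁ ≤ ⋯ ≤ tₙ = b` as the mesh
tends to zero. -/
def HasStieltjesIntegral (f g : ℝ → ℝ) (a b I : ℝ) : Prop :=
  ∀ ε : ℝ, 0 < ε → ∃ δ : ℝ, 0 < δ ∧ ∀ (n : ℕ) (t ξ : ℕ → ℝ), t 0 = a → t n = b →
    (∀ i < n, t i ≤ ξ i ∧ ξ i ≤ t (i + 1) ∧ t (i + 1) - t i < δ) →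
      |∑ i ∈ Finset.range n, f (ξ i) * (g (t (i + 1)) - g (t i)) - I| < ε

/-- The Riemann–Stieltjes integral is unique. -/
theorem HasStieltjesIntegral.unique {f g : ℝ → ℝ} {a b I J : ℝ} (hab : a ≤ b)
    (hI : HasStieltjesIntegral f g a b I) (hJ : HasStieltjesIntegral f g a b J) : I = J := by
  by_contra hne
  have hε : 0 < |I - J| / 2 := by
    have := abs_pos.mpr (sub_ne_zero.mpr hne)
    positivity
  obtain ⟨δ₁, hδ₁, h₁⟩ := hI _ hε
  obtain ⟨δ₂, hδ₂, h₂⟩ := hJ _ hε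
  obtain ⟨n, hn⟩ := exists_nat_gt ((b - a) / min δ₁ δ₂)
  have hδ : 0 < min δ₁ δ₂ := lt_min hδ₁ hδ₂
  have hn0 : (0 : ℝ) < n := lt_of_le_of_lt (div_nonneg (by linarith) hδ.le) hn
  have hstep : (b - a) / n < min δ₁ δ₂ := by
    rw [div_lt_iff₀ hδ] at hn
    rw [div_lt_iff₀ hn0]
    linarith
  have hnn : 0 ≤ (b - a) / n := div_nonneg (by linarith) hn0.le
  let t : ℕ → ℝ := fun i => a + i * ((b - a) / n)
  have ht0 : t 0 = a := by simp [t]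
  have htn : t n = b := by simp only [t]; field_simp; ring
  have hd : ∀ i, t (i + 1) - t i = (b - a) / n := fun i => by simp only [t]; push_cast; ring
  have e₁ := h₁ n t t ht0 htn (fun i _ => ⟨le_rfl, by linarith [hd i],
    by rw [hd i]; exact hstep.trans_le (min_le_left _ _)⟩)
  have e₂ := h₂ n t t ht0 htn (fun i _ => ⟨le_rfl, by linarith [hd i],
    by rw [hd i]; exact hstep.trans_le (min_le_right _ _)⟩)
  rw [abs_lt] at e₁ e₂
  rcases abs_cases (I - J) with h | h <;> linarith [e₁.1, e₁.2, e₂.1, e₂.2, h.1]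

open Classical in
/-- The Riemann–Stieltjes integral `∫_a^b f dg` (it exists for continuous `f` and `g` of bounded
variation; the value is `0` if it does not exist). -/
noncomputable def stieltjesIntegral (f g : ℝ → ℝ) (a b : ℝ) : ℝ :=
  if h : ∃ I, HasStieltjesIntegral f g a b I then h.choose else 0

/-- The entry with index `w = (w₀, …, wₖ₋₁)` of the iterated integral
`X^{(k)}_{a,b} = ∫⋯∫_{a<s₁<⋯<sₖ<b} dX(s₁) ⊗ ⋯ ⊗ dX(sₖ)`, that is,
`∫_a^b (⋯ ∫_a^{s₂} dX_{w₀}(s₁) ⋯) dX_{wₖ₋₁}(sₖ)`. -/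
noncomputable def iteratedIntegral {ι : Type*} (X : ℝ → ι → ℝ) (a : ℝ) :
    (k : ℕ) → (Fin k → ι) → ℝ → ℝ
  | 0, _, _ => 1
  | k + 1, w, b =>
      stieltjesIntegral (fun s => iteratedIntegral X a k (Fin.init w) s)
        (fun s => X s (w (Fin.last k))) a b

/-- Words of length at most `N` over the alphabet `ι`. They index the entries of the truncated
signature: the words of length `k`, in lexicographic order, index the entries of a `k`-fold
Kronecker product. -/
abbrev Word (ι : Type*) (N : ℕ) : Type _ := Σ k : Fin (N + 1), (Fin (k : ℕ) → ι)

/-- The dimension of the truncated signature of an `M`-dimensional path is `∑_{k ≤ N} M ^ k`. -/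
theorem card_word (M N : ℕ) :
    Fintype.card (Word (Fin M) N) = ∑ k ∈ Finset.range (N + 1), M ^ k := by
  simp [Word, Finset.sum_range]

/-- The truncated signature `S^N_{a,b}(X)` of order `N`. -/
noncomputable def truncatedSignature {ι : Type*} (N : ℕ) (X : ℝ → ι → ℝ) (a b : ℝ) :
    Word ι N → ℝ :=
  fun w => iteratedIntegral X a w.1 w.2 b

/-- The time-extended integrated control `Û(t) = (t, ∫₀ᵗ u₁(s) ds, …, ∫₀ᵗ uₘ(s) ds)`. The letter
`0` stands for time, the letter `i + 1` for the `i`-th component of the control. -/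
noncomputable def extendedPath {m : ℕ} (u : ℝ → EuclideanSpace ℝ (Fin m)) (t : ℝ) :
    Fin (m + 1) → ℝ :=
  Fin.cons t (fun i => ∫ s in (0 : ℝ)..t, u s i)

/-- The empty word, which indexes the zeroth entry of the signature. -/
def emptyWord (ι : Type*) (N : ℕ) : Word ι N := ⟨0, Fin.elim0⟩

/-- The matrix `Aᵢ` of the bilinear system of the truncated signature. It maps the unit vector of
a word `v` to the unit vector of the word `v i` obtained by appending the letter `i`, and to `0`
if `v` has the maximal length `N`. -/
def signatureMatrix {ι : Type*} [DecidableEq ι] (N : ℕ) (i : ι) :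
    Matrix (Word ι N) (Word ι N) ℝ :=
  fun w v => if List.ofFn w.2 = List.ofFn v.2 ++ [i] then 1 else 0

/-- The right-hand side `A₀ S + ∑ᵢ Aᵢ S uᵢ(t)` of the bilinear system of the truncated
signature. -/
noncomputable def bilinearField {m : ℕ} (N : ℕ) (u : ℝ → EuclideanSpace ℝ (Fin m)) (t : ℝ)
    (S : Word (Fin (m + 1)) N → ℝ) : Word (Fin (m + 1)) N → ℝ :=
  (signatureMatrix N 0).mulVec S + ∑ i : Fin m, u t i • (signatureMatrix N i.succ).mulVec S

open Filter Topology

/-! Well-posedness. Along a solution, the derivative of ‖x‖² is 2⟨x, f₀(x)⟩ + 2⟨x, f(x)u⟩. Since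
2‖x‖‖f(x)‖‖u‖ ≤ ‖f(x)‖² + ‖x‖²‖u‖², the growth condition bounds it by (G + ‖u‖²)(1 + ‖x‖²), with G ≥
0, and Gronwall confines solutions to a ball that depends only on x₀, T and the energy of u.
Multiplying the coefficients by a cutoff that is 1 on this ball makes them globally Lipschitz and
preserves the growth condition. Picard iteration solves the cut-off equation, and the same bound
shows that the cutoff is never active. A second use of Gronwall gives uniqueness and a Lipschitz
dependence of x on u in L¹, hence in L².

Approximation. The map (t,u) ↦ y(t;u) is continuous on the compact set [0,T] × K, and so is every
signature entry. By the shuffle identity (`exists_iterInt_mul_eq_sum`) the linear span of the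
entries is an algebra; it contains 1. The full signature determines t through the word 0, and it
determines u almost everywhere on [0,t], because the words 0⋯0i give the moments of uᵢ
(`eq_of_iterInt_extendedVelocity_eq`). As y(t;u) depends only on u up to time t, it is a continuous
function on the image of the signature map, where the entries separate points. Stone–Weierstrass
(`exists_finsupp_abs_sub_lt`) approximates it by a finite linear combination of entries, whose
coefficients are the rows of C.

Bilinear system. Stieltjes integrals against Û are Lebesgue integrals against its velocity (1, u),
so the entry of the word vi has derivative the entry of v times the velocity of the letter i. -/

/-! ### Primitives of integrable functions and Gronwall's inequality -/

theorem AbsolutelyContinuousOnInterval.lipschitz_comp {φ f : ℝ → ℝ} {K : NNReal} {s : Set ℝ}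
    {a b : ℝ} (hφ : LipschitzOnWith K φ s) (hf : AbsolutelyContinuousOnInterval f a b)
    (hs : MapsTo f (uIcc a b) s) : AbsolutelyContinuousOnInterval (fun x => φ (f x)) a b := by
  rw [absolutelyContinuousOnInterval_iff] at hf ⊢
  intro ε hε
  obtain ⟨δ, hδ, h⟩ := hf (ε / (K + 1)) (by positivity)
  refine ⟨δ, hδ, fun E hE hlen => ?_⟩
  have h1 := h E hE hlen
  rw [lt_div_iff₀ (by positivity)] at h1
  refine lt_of_le_of_lt ?_ h1
  rw [Finset.sum_mul]
  refine Finset.sum_le_sum fun i hi => ?_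
  have hm := hE.1 i hi
  refine (hφ.dist_le_mul _ (hs hm.1) _ (hs hm.2)).trans ?_
  nlinarith [dist_nonneg (x := f (E.2 i).1) (y := f (E.2 i).2)]

/-- `F` is the primitive on `[0,T]` of the integrable function `f`. -/
def IsPrimitiveOn (T : ℝ) (F f : ℝ → ℝ) : Prop :=
  IntervalIntegrable f volume 0 T ∧ ∀ t ∈ Icc 0 T, F t = F 0 + ∫ s in (0 : ℝ)..t, f s

theorem intervalIntegrable_of_mem_Icc {E : Type*} [NormedAddCommGroup E] {T t : ℝ} {f : ℝ → E}
    (hf : IntervalIntegrable f volume 0 T) (ht : t ∈ Icc 0 T) :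
    IntervalIntegrable f volume 0 t :=
  hf.mono_set (by
    rw [uIcc_of_le ht.1, uIcc_of_le (ht.1.trans ht.2)]
    exact Icc_subset_Icc_right ht.2)

theorem continuousOn_integral_Icc {E : Type*} [NormedAddCommGroup E] [NormedSpace ℝ E] {T : ℝ}
    {f : ℝ → E} (hT : 0 ≤ T) (hf : IntervalIntegrable f volume 0 T) :
    ContinuousOn (fun t => ∫ s in (0 : ℝ)..t, f s) (Icc 0 T) := by
  have h := intervalIntegral.continuousOn_primitive_interval' hf left_mem_uIcc
  rwa [uIcc_of_le hT] at h

namespace IsPrimitiveOn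

variable {T : ℝ} {F G f g : ℝ → ℝ}

theorem integral (c : ℝ) (hf : IntervalIntegrable f volume 0 T) :
    IsPrimitiveOn T (fun t => c + ∫ s in (0 : ℝ)..t, f s) f :=
  ⟨hf, fun t _ => by simp⟩

theorem continuousOn (hT : 0 ≤ T) (hF : IsPrimitiveOn T F f) : ContinuousOn F (Icc 0 T) :=
  (continuousOn_const.add (continuousOn_integral_Icc hT hF.1)).congr hF.2

theorem congr {F' f' : ℝ → ℝ} (hT : 0 ≤ T) (hF : IsPrimitiveOn T F f) (h : EqOn F' F (Icc 0 T))
    (h' : EqOn f' f (Icc 0 T)) : IsPrimitiveOn T F' f' := by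
  refine ⟨hF.1.congr ?_, fun t ht => ?_⟩
  · intro s hs
    rw [uIoc_of_le hT] at hs
    exact (h' (Ioc_subset_Icc_self hs)).symm
  · rw [h ht, h ⟨le_rfl, hT⟩, hF.2 t ht]
    congr 1
    refine intervalIntegral.integral_congr fun s hs => ?_
    rw [uIcc_of_le ht.1] at hs
    exact (h' ⟨hs.1, hs.2.trans ht.2⟩).symm

theorem absolutelyContinuous_integral (c : ℝ) {t : ℝ} (hf : IntervalIntegrable f volume 0 T)
    (ht : t ∈ Icc 0 T) :
    AbsolutelyContinuousOnInterval (fun t => c + ∫ s in (0 : ℝ)..t, f s) 0 t :=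
  ((LipschitzWith.const c).lipschitzOnWith (s := uIcc 0 t)).absolutelyContinuousOnInterval.add
    ((intervalIntegrable_of_mem_Icc hf ht).absolutelyContinuousOnInterval_intervalIntegral
      left_mem_uIcc)

theorem ae_hasDerivAt (c : ℝ) {t : ℝ} (hf : IntervalIntegrable f volume 0 T) (ht : t ∈ Icc 0 T) :
    ∀ᵐ x, x ∈ uIcc 0 t → HasDerivAt (fun t => c + ∫ s in (0 : ℝ)..t, f s) (f x) x := by
  filter_upwards [(intervalIntegrable_of_mem_Icc hf ht).ae_hasDerivAt_integral] with x hx hxt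
  exact (hx hxt 0 left_mem_uIcc).const_add c

theorem integral_eq_sub {H h : ℝ → ℝ} {t : ℝ} (hH : AbsolutelyContinuousOnInterval H 0 t)
    (hd : ∀ᵐ x, x ∈ uIcc 0 t → HasDerivAt H (h x) x) : ∫ s in (0 : ℝ)..t, h s = H t - H 0 := by
  rw [← hH.integral_deriv_eq_sub]
  refine intervalIntegral.integral_congr_ae ?_
  filter_upwards [hd] with x hx hxt
  exact (hx (uIoc_subset_uIcc hxt)).deriv.symm

theorem mul (hT : 0 ≤ T) (hF : IsPrimitiveOn T F f) (hG : IsPrimitiveOn T G g) :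
    IsPrimitiveOn T (fun t => F t * G t) (fun s => f s * G s + F s * g s) := by
  -- F and G are only controlled on [0,T]; their integral representations are absolutely continuous
  -- with known derivatives almost everywhere.
  suffices h : IsPrimitiveOn T (fun t => (F 0 + ∫ s in (0 : ℝ)..t, f s) *
      (G 0 + ∫ s in (0 : ℝ)..t, g s)) (fun t => f t * (G 0 + ∫ s in (0 : ℝ)..t, g s) +
        (F 0 + ∫ s in (0 : ℝ)..t, f s) * g t) by
    refine h.congr hT (fun t ht => ?_) (fun t ht => ?_)
    · simp only [hF.2 t ht, hG.2 t ht]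
    · simp only [hF.2 t ht, hG.2 t ht]
  refine ⟨?_, fun t ht => ?_⟩
  · have hFc := (integral (F 0) hF.1).continuousOn hT
    have hGc := (integral (G 0) hG.1).continuousOn hT
    rw [← uIcc_of_le hT] at hFc hGc
    exact (hF.1.mul_continuousOn hGc).add (hG.1.continuousOn_mul hFc)
  · rw [integral_eq_sub ((absolutelyContinuous_integral (F 0) hF.1 ht).fun_mul
      (absolutelyContinuous_integral (G 0) hG.1 ht))]
    · ring
    · filter_upwards [ae_hasDerivAt (F 0) hF.1 ht, ae_hasDerivAt (G 0) hG.1 ht] with x h1 h2 hx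
      exact (h1 hx).mul (h2 hx)

theorem exp (hT : 0 ≤ T) (hF : IsPrimitiveOn T F f) :
    IsPrimitiveOn T (fun t => Real.exp (F t)) (fun s => f s * Real.exp (F s)) := by
  suffices h : IsPrimitiveOn T (fun t => Real.exp (F 0 + ∫ s in (0 : ℝ)..t, f s))
      (fun t => f t * Real.exp (F 0 + ∫ s in (0 : ℝ)..t, f s)) by
    refine h.congr hT (fun t ht => ?_) (fun t ht => ?_)
    · simp only [hF.2 t ht]
    · simp only [hF.2 t ht]
  have hFc := (integral (F 0) hF.1).continuousOn hT
  refine ⟨?_, fun t ht => ?_⟩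
  · rw [← uIcc_of_le hT] at hFc
    exact hF.1.mul_continuousOn hFc.rexp
  · have hac := absolutelyContinuous_integral (F 0) hF.1 ht
    obtain ⟨M, hM⟩ := hac.exists_bound
    -- The exponential is not globally Lipschitz, but it is on the range of the bounded inner
    -- function.
    have hlip : LipschitzOnWith (Real.exp M).toNNReal Real.exp (Icc (-M) M) := by
      refine (convex_Icc _ _).lipschitzOnWith_of_nnnorm_deriv_le
        (fun x _ => Real.differentiable_exp x) fun x hx => ?_
      rw [← NNReal.coe_le_coe, coe_nnnorm, Real.deriv_exp, Real.norm_eq_abs, Real.abs_exp,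
        Real.coe_toNNReal _ (Real.exp_pos _).le]
      exact Real.exp_le_exp.2 hx.2
    rw [integral_eq_sub (AbsolutelyContinuousOnInterval.lipschitz_comp hlip hac
      fun x hx => abs_le.1 (hM x hx))]
    · ring
    · filter_upwards [ae_hasDerivAt (F 0) hF.1 ht] with x h1 hx
      rw [mul_comm]
      exact (h1 hx).exp

end IsPrimitiveOn

/-- Gronwall's inequality with an integrable coefficient. -/
theorem le_mul_exp_of_le_add_integral {T c : ℝ} (hT : 0 ≤ T) {a φ : ℝ → ℝ}
    (ha : IntervalIntegrable a volume 0 T) (ha0 : ∀ t ∈ Icc 0 T, 0 ≤ a t)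
    (hφ : ContinuousOn φ (Icc 0 T))
    (h : ∀ t ∈ Icc 0 T, φ t ≤ c + ∫ s in (0 : ℝ)..t, a s * φ s) :
    ∀ t ∈ Icc 0 T, φ t ≤ c * Real.exp (∫ s in (0 : ℝ)..t, a s) := by
  intro t ht
  have haφ : IntervalIntegrable (fun s => a s * φ s) volume 0 T :=
    ha.mul_continuousOn (by rwa [uIcc_of_le hT])
  -- Integrating factor: the derivative of (c + ∫aφ) exp(-∫a) is a (φ - c - ∫aφ) exp(-∫a), which is
  -- nonpositive by hypothesis.
  have hP := (IsPrimitiveOn.integral c haφ).mul hT ((IsPrimitiveOn.integral 0 ha.neg).exp hT)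
  have hle := hP.2 t ht
  simp only [intervalIntegral.integral_same, add_zero, zero_add, Real.exp_zero, mul_one] at hle
  have hneg : ∫ s in (0 : ℝ)..t, (a s * φ s * Real.exp (∫ r in (0 : ℝ)..s, (-a) r) +
      (c + ∫ r in (0 : ℝ)..s, a r * φ r) * ((-a) s * Real.exp (∫ r in (0 : ℝ)..s, (-a) r))) ≤
      0 := by
    rw [intervalIntegral.integral_of_le ht.1]
    refine setIntegral_nonpos measurableSet_Ioc fun s hs => ?_
    have hs' : s ∈ Icc 0 T := ⟨hs.1.le, hs.2.trans ht.2⟩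
    have h1 := mul_nonneg (ha0 s hs') (Real.exp_pos (∫ r in (0 : ℝ)..s, (-a) r)).le
    have h2 := mul_nonneg h1 (sub_nonneg.2 (h s hs'))
    simp only [Pi.neg_apply] at h2 ⊢
    linarith
  have hA : ∫ r in (0 : ℝ)..t, (-a) r = - ∫ r in (0 : ℝ)..t, a r := by
    simp [intervalIntegral.integral_neg]
  rw [hA, Real.exp_neg] at hle
  have hpos := Real.exp_pos (∫ r in (0 : ℝ)..t, a r)
  have hfin : (c + ∫ s in (0 : ℝ)..t, a s * φ s) * (Real.exp (∫ r in (0 : ℝ)..t, a r))⁻¹ ≤ c := by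
    linarith
  rw [← div_eq_mul_inv, div_le_iff₀ hpos] at hfin
  exact (h t ht).trans hfin

/-! ### Riemann–Stieltjes integrals as Lebesgue integrals -/

/-- The Riemann–Stieltjes integral of a continuous function against a primitive. -/
theorem hasStieltjesIntegral_integral {f g h : ℝ → ℝ} {b : ℝ} (hb : 0 ≤ b)
    (hf : ContinuousOn f (Icc 0 b)) (hh : IntervalIntegrable h volume 0 b)
    (hg : ∀ t ∈ Icc 0 b, g t = ∫ s in (0 : ℝ)..t, h s) :
    HasStieltjesIntegral f g 0 b (∫ s in (0 : ℝ)..b, f s * h s) := by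
  intro ε hε
  have hI0 : 0 ≤ ∫ s in (0 : ℝ)..b, |h s| :=
    intervalIntegral.integral_nonneg hb fun s _ => abs_nonneg _
  set I := ∫ s in (0 : ℝ)..b, |h s| with hI
  -- The error is at most the oscillation of f on the mesh times I, the integral of |h|; the summand
  -- 1 allows for I = 0.
  obtain ⟨δ, hδ, huc⟩ := Metric.uniformContinuousOn_iff.1
    (isCompact_Icc.uniformContinuousOn_of_continuous hf) (ε / (I + 1)) (by positivity)
  refine ⟨δ, hδ, fun n t ξ ht0 htn hpart => ?_⟩
  have hmono : ∀ i j, i ≤ j → j ≤ n → t i ≤ t j := by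
    intro i j hij
    induction j, hij using Nat.le_induction with
    | base => exact fun _ => le_rfl
    | succ j _ ih =>
      intro hj
      have := hpart j (by omega)
      exact (ih (by omega)).trans (this.1.trans this.2.1)
  have hmem : ∀ i ≤ n, t i ∈ Icc 0 b := fun i hi =>
    ⟨ht0 ▸ hmono 0 i (Nat.zero_le _) hi, htn ▸ hmono i n hi le_rfl⟩
  have hsub : ∀ i < n, uIcc (t i) (t (i + 1)) ⊆ uIcc 0 b := fun i hi =>
    uIcc_subset_uIcc (by rw [uIcc_of_le hb]; exact hmem i hi.le)
      (by rw [uIcc_of_le hb]; exact hmem _ hi)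
  have hfh : IntervalIntegrable (fun s => f s * h s) volume 0 b :=
    hh.continuousOn_mul (by rwa [uIcc_of_le hb])
  have hsum : ∫ s in (0 : ℝ)..b, f s * h s =
      ∑ i ∈ Finset.range n, ∫ s in t i..t (i + 1), f s * h s := by
    rw [intervalIntegral.sum_integral_adjacent_intervals
      (fun i hi => hfh.mono_set (hsub i hi)), ht0, htn]
  have hsumI : I = ∑ i ∈ Finset.range n, ∫ s in t i..t (i + 1), |h s| := by
    rw [intervalIntegral.sum_integral_adjacent_intervals
      (fun i hi => hh.abs.mono_set (hsub i hi)), ht0, htn]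
  rw [hsum, ← Finset.sum_sub_distrib]
  have hterm : ∀ i ∈ Finset.range n, |f (ξ i) * (g (t (i + 1)) - g (t i)) -
      ∫ s in t i..t (i + 1), f s * h s| ≤ ε / (I + 1) * ∫ s in t i..t (i + 1), |h s| := by
    intro i hi
    have hi' := Finset.mem_range.1 hi
    obtain ⟨h1, h2, h3⟩ := hpart i hi'
    have hle : t i ≤ t (i + 1) := h1.trans h2
    have hti := hmem i hi'.le
    have hti1 := hmem (i + 1) hi'
    have hhi := hh.mono_set (hsub i hi')
    have hξ : ξ i ∈ Icc 0 b := ⟨hti.1.trans h1, h2.trans hti1.2⟩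
    have hgd : g (t (i + 1)) - g (t i) = ∫ s in t i..t (i + 1), h s := by
      rw [hg _ hti, hg _ hti1]
      exact intervalIntegral.integral_interval_sub_left (intervalIntegrable_of_mem_Icc hh hti1)
        (intervalIntegrable_of_mem_Icc hh hti)
    rw [hgd, ← intervalIntegral.integral_const_mul, ← intervalIntegral.integral_sub
      (hhi.const_mul _) (hfh.mono_set (hsub i hi')), ← intervalIntegral.integral_const_mul,
      ← Real.norm_eq_abs]
    refine intervalIntegral.norm_integral_le_of_norm_le hle ?_ (hhi.abs.const_mul _)
    refine Eventually.of_forall fun s hs => ?_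
    rw [← sub_mul, norm_mul, Real.norm_eq_abs (h s)]
    refine mul_le_mul_of_nonneg_right ?_ (abs_nonneg _)
    have hs' : s ∈ Icc 0 b := ⟨hti.1.trans hs.1.le, hs.2.trans hti1.2⟩
    refine (huc _ hξ _ hs' ?_).le
    rw [Real.dist_eq, abs_lt]
    constructor <;> linarith [hs.1, hs.2]
  calc _ ≤ _ := Finset.abs_sum_le_sum_abs _ _
    _ ≤ _ := Finset.sum_le_sum hterm
    _ = ε / (I + 1) * I := by rw [← Finset.mul_sum, ← hsumI]
    _ < ε := by
      rw [div_mul_eq_mul_div, div_lt_iff₀ (by positivity)]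
      nlinarith

theorem stieltjesIntegral_eq_integral {f g h : ℝ → ℝ} {b : ℝ} (hb : 0 ≤ b)
    (hf : ContinuousOn f (Icc 0 b)) (hh : IntervalIntegrable h volume 0 b)
    (hg : ∀ t ∈ Icc 0 b, g t = ∫ s in (0 : ℝ)..t, h s) :
    stieltjesIntegral f g 0 b = ∫ s in (0 : ℝ)..b, f s * h s := by
  have hI := hasStieltjesIntegral_integral hb hf hh hg
  have hex : ∃ I, HasStieltjesIntegral f g 0 b I := ⟨_, hI⟩
  rw [stieltjesIntegral, dif_pos hex]
  exact hex.choose_spec.unique hb hI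

/-! ### Picard iteration with an integrable Lipschitz constant -/

section Picard

variable {E : Type*} [NormedAddCommGroup E] [NormedSpace ℝ E]

theorem IsSolutionOn.mono {T t : ℝ} {F : ℝ → E → E} {x₀ : E} {x : ℝ → E}
    (hx : IsSolutionOn T F x₀ x) (ht : t ≤ T) : IsSolutionOn t F x₀ x :=
  ⟨hx.1.mono (Icc_subset_Icc_right ht), fun s hs => hx.2 s ⟨hs.1, hs.2.trans ht⟩⟩

theorem IsSolutionOn.congr_field {T : ℝ} {F F' : ℝ → E → E} {x₀ : E} {x : ℝ → E}
    (hx : IsSolutionOn T F x₀ x) (h : ∀ s ∈ Icc 0 T, F s (x s) = F' s (x s)) :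
    IsSolutionOn T F' x₀ x := by
  refine ⟨hx.1, fun t ht => ⟨(hx.2 t ht).1.congr fun s hs => ?_, ?_⟩⟩
  · rw [uIoc_of_le ht.1] at hs
    exact h s ⟨hs.1.le, hs.2.trans ht.2⟩
  · rw [(hx.2 t ht).2]
    congr 1
    refine intervalIntegral.integral_congr fun s hs => ?_
    rw [uIcc_of_le ht.1] at hs
    exact h s ⟨hs.1, hs.2.trans ht.2⟩

/-- The Picard operator on continuous functions on `[0,T]`. -/
noncomputable def picardMap {T : ℝ} (hT : 0 ≤ T) {F : ℝ → E → E}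
    (hF : ∀ x : ℝ → E, Continuous x → IntervalIntegrable (fun s => F s (x s)) volume 0 T)
    (x₀ : E) (x : C(Icc 0 T, E)) : C(Icc 0 T, E) where
  toFun t := x₀ + ∫ s in (0 : ℝ)..t, F s (IccExtend hT x s)
  continuous_toFun := continuous_const.add (continuousOn_iff_continuous_domRestrict.1
    (continuousOn_integral_Icc hT (hF _ x.continuous.Icc_extend')))

/-- The weight E(t) = exp(∫₀ᵗ 2a) satisfies ∫₀ᵗ aE = (E(t) - 1)/2, so each application of the Picard
operator gains a factor 1/2 in the weighted norm, however large the integral of a is. -/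
theorem norm_picardMap_iterate_sub_le {T : ℝ} (hT : 0 ≤ T) {F : ℝ → E → E} {a : ℝ → ℝ}
    (hF : ∀ x : ℝ → E, Continuous x → IntervalIntegrable (fun s => F s (x s)) volume 0 T)
    (ha : IntervalIntegrable a volume 0 T) (ha0 : ∀ s ∈ Icc 0 T, 0 ≤ a s)
    (hL : ∀ s ∈ Icc 0 T, ∀ x z, ‖F s x - F s z‖ ≤ a s * ‖x - z‖) (x₀ : E)
    (x y : C(Icc 0 T, E)) (n : ℕ) (t : Icc 0 T) :
    ‖(picardMap hT hF x₀)^[n] x t - (picardMap hT hF x₀)^[n] y t‖ ≤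
      (1 / 2) ^ n * dist x y * Real.exp (∫ s in (0 : ℝ)..t, 2 * a s) := by
  induction n generalizing t with
  | zero =>
    have h1 : 1 ≤ Real.exp (∫ s in (0 : ℝ)..t, 2 * a s) := by
      refine Real.one_le_exp (intervalIntegral.integral_nonneg t.2.1 fun s hs => ?_)
      have := ha0 s ⟨hs.1, hs.2.trans t.2.2⟩
      positivity
    rw [Function.iterate_zero, id, id, pow_zero, one_mul, ← dist_eq_norm]
    exact (ContinuousMap.dist_apply_le_dist t).trans (le_mul_of_one_le_right dist_nonneg h1)
  | succ n ih =>
    rw [Function.iterate_succ_apply', Function.iterate_succ_apply']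
    set X := (picardMap hT hF x₀)^[n] x
    set Y := (picardMap hT hF x₀)^[n] y
    have hX := intervalIntegrable_of_mem_Icc (hF _ (X.continuous.Icc_extend' (h := hT))) t.2
    have hY := intervalIntegrable_of_mem_Icc (hF _ (Y.continuous.Icc_extend' (h := hT))) t.2
    have hexp := (IsPrimitiveOn.integral 0 (ha.const_mul 2)).exp hT
    have hval := hexp.2 t t.2
    simp only [zero_add, intervalIntegral.integral_same, Real.exp_zero] at hval
    have hint := intervalIntegrable_of_mem_Icc hexp.1 t.2
    simp only [zero_add] at hint
    have h1 : picardMap hT hF x₀ X t - picardMap hT hF x₀ Y t =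
        ∫ s in (0 : ℝ)..t, (F s (IccExtend hT X s) - F s (IccExtend hT Y s)) := by
      rw [intervalIntegral.integral_sub hX hY]
      simp [picardMap]
    rw [h1]
    have h2 : ‖∫ s in (0 : ℝ)..t, (F s (IccExtend hT X s) - F s (IccExtend hT Y s))‖ ≤
        ∫ s in (0 : ℝ)..t, (1 / 2) ^ (n + 1) * dist x y *
          (2 * a s * Real.exp (∫ r in (0 : ℝ)..s, 2 * a r)) := by
      refine intervalIntegral.norm_integral_le_of_norm_le t.2.1
        (Eventually.of_forall fun s hs => ?_) (hint.const_mul _)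
      have hs' : s ∈ Icc 0 T := ⟨hs.1.le, hs.2.trans t.2.2⟩
      refine (hL s hs' _ _).trans ?_
      rw [IccExtend_of_mem _ _ hs', IccExtend_of_mem _ _ hs']
      refine (mul_le_mul_of_nonneg_left (ih ⟨s, hs'⟩) (ha0 s hs')).trans (le_of_eq ?_)
      rw [pow_succ]
      ring
    refine h2.trans ?_
    rw [intervalIntegral.integral_const_mul]
    refine mul_le_mul_of_nonneg_left ?_ (by positivity)
    linarith

/-- Carathéodory equations with a Lipschitz constant that is integrable in time are solvable. -/
theorem exists_isSolutionOn [CompleteSpace E] {T : ℝ} (hT : 0 ≤ T) {F : ℝ → E → E} {a : ℝ → ℝ}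
    (hF : ∀ x : ℝ → E, Continuous x → IntervalIntegrable (fun s => F s (x s)) volume 0 T)
    (ha : IntervalIntegrable a volume 0 T) (ha0 : ∀ s ∈ Icc 0 T, 0 ≤ a s)
    (hL : ∀ s ∈ Icc 0 T, ∀ x z, ‖F s x - F s z‖ ≤ a s * ‖x - z‖) (x₀ : E) :
    ∃ x, IsSolutionOn T F x₀ x := by
  set B := Real.exp (∫ s in (0 : ℝ)..T, 2 * a s) with hB
  -- B is the largest value of the weight; this n makes the n-th iterate a 1/2-contraction in the
  -- unweighted supremum norm.
  obtain ⟨n, hn⟩ := exists_pow_lt_of_lt_one (show (0 : ℝ) < 1 / (2 * B) by positivity)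
    (show (1 / 2 : ℝ) < 1 by norm_num)
  have hcontr : ContractingWith (1 / 2) (picardMap hT hF x₀)^[n] := by
    refine ⟨by rw [← NNReal.coe_lt_coe]; norm_num, LipschitzWith.of_dist_le_mul fun x y => ?_⟩
    rw [ContinuousMap.dist_le (by positivity)]
    intro t
    rw [dist_eq_norm]
    refine (norm_picardMap_iterate_sub_le hT hF ha ha0 hL x₀ x y n t).trans ?_
    have hmono : Real.exp (∫ s in (0 : ℝ)..t, 2 * a s) ≤ B := by
      refine Real.exp_le_exp.2 (intervalIntegral.integral_mono_interval le_rfl t.2.1 t.2.2 ?_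
        (ha.const_mul 2))
      filter_upwards [ae_restrict_mem measurableSet_Ioc] with s hs
      have := ha0 s (Ioc_subset_Icc_self hs)
      simp only [Pi.zero_apply]
      positivity
    have hBpos : 0 < B := Real.exp_pos _
    have h3 : (1 / 2 : ℝ) ^ n * B ≤ 1 / 2 := by
      have := mul_le_mul_of_nonneg_right hn.le hBpos.le
      refine this.trans (le_of_eq ?_)
      field_simp
    calc _ ≤ (1 / 2) ^ n * dist x y * B := by gcongr
      _ = ((1 / 2) ^ n * B) * dist x y := by ring
      _ ≤ _ := by
        push_cast
        gcongr
  have hne : Nonempty C(Icc 0 T, E) := ⟨0⟩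
  -- The unique fixed point of the iterate is also fixed by the Picard operator itself.
  have hfix := hcontr.isFixedPt_fixedPoint_iterate
  set x := hcontr.fixedPoint
  have hxt : ∀ t : Icc 0 T, x t = x₀ + ∫ s in (0 : ℝ)..t, F s (IccExtend hT x s) := fun t =>
    (DFunLike.congr_fun hfix t).symm
  refine ⟨IccExtend hT x, x.continuous.Icc_extend'.continuousOn, fun t ht =>
    ⟨intervalIntegrable_of_mem_Icc (hF _ x.continuous.Icc_extend') ht, ?_⟩⟩
  rw [IccExtend_of_mem _ _ ht]
  exact hxt ⟨t, ht⟩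

end Picard

/-! ### Locally Lipschitz maps and cutoffs -/

section LipschitzOnBalls

variable {E F : Type*} [NormedAddCommGroup E] [NormedAddCommGroup F]

theorem LipschitzOnBalls.continuous {g : E → F}
    (hg : LipschitzOnBalls g) : Continuous g := by
  rw [continuous_iff_continuousAt]
  intro x
  obtain ⟨L, hL, h⟩ := hg (‖x‖ + 1) (by positivity)
  refine continuousAt_of_locally_lipschitz one_pos L fun y hy => ?_
  rw [dist_eq_norm, dist_eq_norm]
  refine h y x ?_ (by linarith)
  rw [dist_eq_norm] at hy
  linarith [norm_le_norm_add_norm_sub x y, norm_sub_rev x y]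

theorem LipschitzOnBalls.exists_bound {g : E → F}
    (hg : LipschitzOnBalls g) {R : ℝ} (hR : 0 < R) :
    ∃ M, 0 ≤ M ∧ ∀ x, ‖x‖ ≤ R → ‖g x‖ ≤ M := by
  obtain ⟨L, hL, h⟩ := hg R hR
  refine ⟨‖g 0‖ + L * R, by positivity, fun x hx => ?_⟩
  have h1 := h x 0 hx (by simpa using hR.le)
  rw [sub_zero] at h1
  have h2 := norm_le_norm_add_norm_sub (g 0) (g x)
  rw [norm_sub_rev] at h2
  nlinarith

/-- A Lipschitz function with support in the ball of radius `R + 1` which equals `1` on the ball of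
radius `R`. -/
noncomputable def ballCutoff (R : ℝ) (x : E) : ℝ := max 0 (min 1 (R + 1 - ‖x‖))

theorem ballCutoff_nonneg (R : ℝ) (x : E) : 0 ≤ ballCutoff R x := le_max_left _ _

theorem ballCutoff_le_one (R : ℝ) (x : E) : ballCutoff R x ≤ 1 :=
  max_le zero_le_one (min_le_left _ _)

theorem ballCutoff_eq_one {R : ℝ} {x : E} (hx : ‖x‖ ≤ R) : ballCutoff R x = 1 := by
  rw [ballCutoff, min_eq_left (by linarith), max_eq_right zero_le_one]

theorem ballCutoff_eq_zero {R : ℝ} {x : E} (hx : R + 1 ≤ ‖x‖) : ballCutoff R x = 0 :=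
  max_eq_left ((min_le_right _ _).trans (by linarith))

theorem abs_ballCutoff_sub_le (R : ℝ) (x z : E) :
    |ballCutoff R x - ballCutoff R z| ≤ ‖x - z‖ := by
  have h1 := abs_max_sub_max_le_abs (min 1 (R + 1 - ‖x‖)) (min 1 (R + 1 - ‖z‖)) 0
  have h2 := abs_min_sub_min_le_max 1 (R + 1 - ‖x‖) 1 (R + 1 - ‖z‖)
  rw [sub_self, abs_zero, max_eq_right (abs_nonneg _)] at h2
  have h3 : |R + 1 - ‖x‖ - (R + 1 - ‖z‖)| ≤ ‖x - z‖ := by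
    rw [show R + 1 - ‖x‖ - (R + 1 - ‖z‖) = ‖z‖ - ‖x‖ by ring, norm_sub_rev]
    exact abs_norm_sub_norm_le z x
  rw [ballCutoff, ballCutoff, max_comm 0, max_comm 0]
  exact h1.trans (h2.trans h3)

/-- Inside the ball of radius R + 1 this is the product of two bounded Lipschitz functions. If one
point lies outside, the cutoff vanishes there and its own Lipschitz bound suffices. -/
theorem LipschitzOnBalls.ballCutoff_smul [NormedSpace ℝ F]
    {h : E → F} (hh : LipschitzOnBalls h) {R : ℝ} (hR : 0 < R) :
    ∃ L, 0 ≤ L ∧ ∀ x z, ‖ballCutoff R x • h x - ballCutoff R z • h z‖ ≤ L * ‖x - z‖ := by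
  obtain ⟨L, hL, hlip⟩ := hh (R + 1) (by positivity)
  obtain ⟨M, hM, hb⟩ := hh.exists_bound (show 0 < R + 1 by positivity)
  have key : ∀ x z, ‖x‖ ≤ R + 1 →
      ‖ballCutoff R x • h x - ballCutoff R z • h z‖ ≤ (M + L) * ‖x - z‖ := by
    intro x z hx
    have hχ := mul_le_mul (abs_ballCutoff_sub_le R x z) (hb x hx) (norm_nonneg _) (norm_nonneg _)
    rcases le_total ‖z‖ (R + 1) with hz | hz
    · have h1 := hlip x z hx hz
      have heq : ballCutoff R x • h x - ballCutoff R z • h z =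
          (ballCutoff R x - ballCutoff R z) • h x + ballCutoff R z • (h x - h z) := by
        rw [sub_smul, smul_sub]
        abel
      rw [heq]
      refine (norm_add_le _ _).trans ?_
      rw [norm_smul, norm_smul, Real.norm_eq_abs, Real.norm_of_nonneg (ballCutoff_nonneg R z)]
      have h2 := mul_le_mul_of_nonneg_right (ballCutoff_le_one R z) (norm_nonneg (h x - h z))
      linarith
    · rw [ballCutoff_eq_zero hz] at hχ ⊢
      rw [sub_zero] at hχ
      rw [zero_smul, sub_zero, norm_smul, Real.norm_eq_abs]
      nlinarith [norm_nonneg (x - z)]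
  refine ⟨M + L, by positivity, fun x z => ?_⟩
  rcases le_total ‖x‖ (R + 1) with hx | hx
  · exact key x z hx
  rcases le_total ‖z‖ (R + 1) with hz | hz
  · rw [norm_sub_rev, norm_sub_rev x z]
    exact key z x hz
  · rw [ballCutoff_eq_zero hx, ballCutoff_eq_zero hz, zero_smul, zero_smul, sub_self, norm_zero]
    positivity

end LipschitzOnBalls

/-! ### Stability and uniqueness for control-affine equations -/

section ControlAffine

variable {E U : Type*} [NormedAddCommGroup E] [NormedSpace ℝ E] [NormedAddCommGroup U]
  [NormedSpace ℝ U]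

theorem intervalIntegrable_clm_apply {T : ℝ} (hT : 0 ≤ T) {A : ℝ → U →L[ℝ] E} {u : ℝ → U}
    (hA : ContinuousOn A (Icc 0 T)) (hu : IntervalIntegrable u volume 0 T) :
    IntervalIntegrable (fun s => A s (u s)) volume 0 T := by
  obtain ⟨C, hC⟩ := isCompact_Icc.exists_bound_of_continuousOn hA
  refine (hu.norm.const_mul C).mono_fun ?_ ?_
  · have hAm : AEStronglyMeasurable A (volume.restrict (uIoc 0 T)) := by
      rw [uIoc_of_le hT]
      exact (hA.aestronglyMeasurable measurableSet_Icc).mono_measure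
        (Measure.restrict_mono Ioc_subset_Icc_self le_rfl)
    exact isBoundedBilinearMap_apply.continuous.comp_aestronglyMeasurable
      (hAm.prodMk hu.aestronglyMeasurable_restrict_uIoc)
  · rw [uIoc_of_le hT]
    filter_upwards [ae_restrict_mem measurableSet_Ioc] with s hs
    refine ((A s).le_opNorm _).trans ?_
    refine le_trans ?_ (le_abs_self _)
    exact mul_le_mul_of_nonneg_right (hC s (Ioc_subset_Icc_self hs)) (norm_nonneg _)

/-- Stability of the solutions of control-affine equations with respect to the control. -/
theorem norm_sub_le_of_isSolutionOn {T R L M : ℝ} (hT : 0 ≤ T) (hL0 : 0 ≤ L) (hM0 : 0 ≤ M)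
    {g₀ : E → E} {g : E → U →L[ℝ] E}
    (hg₀ : ∀ x z, ‖x‖ ≤ R → ‖z‖ ≤ R → ‖g₀ x - g₀ z‖ ≤ L * ‖x - z‖)
    (hg : ∀ x z, ‖x‖ ≤ R → ‖z‖ ≤ R → ‖g x - g z‖ ≤ L * ‖x - z‖)
    (hM : ∀ z, ‖z‖ ≤ R → ‖g z‖ ≤ M) {u v : ℝ → U}
    (hu : IntervalIntegrable u volume 0 T) (hv : IntervalIntegrable v volume 0 T)
    {x₀ : E} {x z : ℝ → E} (hx : IsSolutionOn T (fun t y => g₀ y + g y (u t)) x₀ x)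
    (hz : IsSolutionOn T (fun t y => g₀ y + g y (v t)) x₀ z)
    (hxR : ∀ t ∈ Icc 0 T, ‖x t‖ ≤ R) (hzR : ∀ t ∈ Icc 0 T, ‖z t‖ ≤ R) :
    ∀ t ∈ Icc 0 T, ‖x t - z t‖ ≤ (M * ∫ s in (0 : ℝ)..T, ‖u s - v s‖) *
      Real.exp (∫ s in (0 : ℝ)..t, L * (1 + ‖u s‖)) := by
  have ha : IntervalIntegrable (fun s => L * (1 + ‖u s‖)) volume 0 T :=
    (intervalIntegrable_const.add hu.norm).const_mul L
  have huv := (hu.sub hv).norm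
  have hφ : ContinuousOn (fun t => ‖x t - z t‖) (Icc 0 T) := (hx.1.sub hz.1).norm
  have haφ : IntervalIntegrable (fun s => L * (1 + ‖u s‖) * ‖x s - z s‖) volume 0 T :=
    ha.mul_continuousOn (by rwa [uIcc_of_le hT])
  refine le_mul_exp_of_le_add_integral hT ha (fun t _ => by positivity) hφ fun t ht => ?_
  have huvt : ∫ s in (0 : ℝ)..t, ‖u s - v s‖ ≤ ∫ s in (0 : ℝ)..T, ‖u s - v s‖ :=
    intervalIntegral.integral_mono_interval le_rfl ht.1 ht.2
      (Eventually.of_forall fun s => norm_nonneg _) huv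
  rw [(hx.2 t ht).2, (hz.2 t ht).2, add_sub_add_left_eq_sub,
    ← intervalIntegral.integral_sub (hx.2 t ht).1 (hz.2 t ht).1]
  refine (intervalIntegral.norm_integral_le_of_norm_le ht.1
    (g := fun s => M * ‖u s - v s‖ + L * (1 + ‖u s‖) * ‖x s - z s‖)
    (Eventually.of_forall fun s hs => ?_) ?_).trans ?_
  · have hs' : s ∈ Icc 0 T := ⟨hs.1.le, hs.2.trans ht.2⟩
    have h1 := hg₀ _ _ (hxR s hs') (hzR s hs')
    have h2 := (g (x s) - g (z s)).le_of_opNorm_le (hg _ _ (hxR s hs') (hzR s hs')) (u s)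
    have h3 := (g (z s)).le_of_opNorm_le (hM _ (hzR s hs')) (u s - v s)
    -- The difference of the states is paired with u, which gives the Gronwall coefficient L(1 +
    -- ‖u‖); the difference of the controls is paired with g(z), which is bounded by M.
    have heq : g₀ (x s) + g (x s) (u s) - (g₀ (z s) + g (z s) (v s)) =
        (g₀ (x s) - g₀ (z s)) + (g (x s) - g (z s)) (u s) + g (z s) (u s - v s) := by
      simp only [_root_.sub_apply, map_sub]
      abel
    rw [heq]
    refine (norm_add₃_le).trans ?_
    linarith
  · exact ((huv.const_mul M).add haφ).mono_set (by
      rw [uIcc_of_le ht.1, uIcc_of_le hT]; exact Icc_subset_Icc_right ht.2)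
  · rw [intervalIntegral.integral_add (intervalIntegrable_of_mem_Icc (huv.const_mul M) ht)
      (intervalIntegrable_of_mem_Icc haφ ht), intervalIntegral.integral_const_mul]
    gcongr

/-- Solutions of control-affine equations with locally Lipschitz coefficients agree on `[0,T]` if
the controls do. -/
theorem eqOn_of_isSolutionOn {T : ℝ} (hT : 0 ≤ T) {g₀ : E → E} {g : E → U →L[ℝ] E}
    (hg₀ : LipschitzOnBalls g₀) (hg : LipschitzOnBalls g) {u v : ℝ → U}
    (hu : IntervalIntegrable u volume 0 T) (hv : IntervalIntegrable v volume 0 T)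
    (huv : ∀ᵐ s, s ∈ Ioc 0 T → u s = v s)
    {x₀ : E} {x z : ℝ → E} (hx : IsSolutionOn T (fun t y => g₀ y + g y (u t)) x₀ x)
    (hz : IsSolutionOn T (fun t y => g₀ y + g y (v t)) x₀ z) : EqOn x z (Icc 0 T) := by
  obtain ⟨C₁, hC₁⟩ := isCompact_Icc.exists_bound_of_continuousOn hx.1
  obtain ⟨C₂, hC₂⟩ := isCompact_Icc.exists_bound_of_continuousOn hz.1
  -- Both trajectories are bounded on the compact interval, so one ball contains them.
  have hR : 0 < max 1 (max C₁ C₂) := lt_max_of_lt_left one_pos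
  obtain ⟨L₀, hL₀, h₀⟩ := hg₀ _ hR
  obtain ⟨L₁, hL₁, h₁⟩ := hg _ hR
  obtain ⟨M, hM0, hM⟩ := hg.exists_bound hR
  intro t ht
  have h := norm_sub_le_of_isSolutionOn hT (hL₀.le.trans (le_max_left L₀ L₁)) hM0
    (fun x z hx hz => (h₀ x z hx hz).trans
      (mul_le_mul_of_nonneg_right (le_max_left _ _) (norm_nonneg _)))
    (fun x z hx hz => (h₁ x z hx hz).trans
      (mul_le_mul_of_nonneg_right (le_max_right _ _) (norm_nonneg _)))
    hM hu hv hx hz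
    (fun t ht => (hC₁ t ht).trans ((le_max_left _ _).trans (le_max_right _ _)))
    (fun t ht => (hC₂ t ht).trans ((le_max_right _ _).trans (le_max_right _ _))) t ht
  have h0 : ∫ s in (0 : ℝ)..T, ‖u s - v s‖ = 0 := by
    refine intervalIntegral.integral_zero_ae ?_
    filter_upwards [huv] with s hs hs'
    rw [uIoc_of_le hT] at hs'
    rw [hs hs', sub_self, norm_zero]
  rw [h0, mul_zero, zero_mul] at h
  exact sub_eq_zero.1 (norm_le_zero_iff.1 h)

end ControlAffine

/-! ### A priori bound, existence and dependence on the control -/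

theorem IsPrimitiveOn.sum {ι : Type*} (s : Finset ι) {T : ℝ} {F f : ι → ℝ → ℝ}
    (h : ∀ i ∈ s, IsPrimitiveOn T (F i) (f i)) :
    IsPrimitiveOn T (fun t => ∑ i ∈ s, F i t) (fun t => ∑ i ∈ s, f i t) := by
  refine ⟨?_, fun t ht => ?_⟩
  · have := IntervalIntegrable.sum s fun i hi => (h i hi).1
    simpa only [Finset.sum_fn] using this
  · rw [intervalIntegral.integral_finsetSum
      fun i hi => intervalIntegrable_of_mem_Icc (h i hi).1 ht, ← Finset.sum_add_distrib]
    exact Finset.sum_congr rfl fun i hi => (h i hi).2 t ht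

theorem isPrimitiveOn_norm_sq_of_isSolutionOn {d : ℕ} {T : ℝ} (hT : 0 ≤ T)
    {F : ℝ → EuclideanSpace ℝ (Fin d) → EuclideanSpace ℝ (Fin d)}
    {x₀ : EuclideanSpace ℝ (Fin d)} {x : ℝ → EuclideanSpace ℝ (Fin d)}
    (hx : IsSolutionOn T F x₀ x) :
    IsPrimitiveOn T (fun t => ‖x t‖ ^ 2) (fun t => 2 * inner ℝ (x t) (F t (x t))) := by
  have h0 : x 0 = x₀ := by simpa using (hx.2 0 ⟨le_rfl, hT⟩).2
  have hi : ∀ i, IsPrimitiveOn T (fun t => x t i) (fun t => F t (x t) i) := by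
    intro i
    refine ⟨?_, fun t ht => ?_⟩
    · have h := (hx.2 T ⟨hT, le_rfl⟩).1
      exact ⟨(EuclideanSpace.proj i : _ →L[ℝ] ℝ).integrable_comp h.1,
        (EuclideanSpace.proj i : _ →L[ℝ] ℝ).integrable_comp h.2⟩
    · have h : ∫ s in (0 : ℝ)..t, F s (x s) i = (∫ s in (0 : ℝ)..t, F s (x s)) i :=
        (EuclideanSpace.proj i : _ →L[ℝ] ℝ).intervalIntegral_comp_comm (hx.2 t ht).1
      simp only [h, h0]
      conv_lhs => rw [(hx.2 t ht).2]
      rfl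
  refine (IsPrimitiveOn.sum Finset.univ fun i _ => (hi i).mul hT (hi i)).congr hT
    (fun t _ => ?_) (fun t _ => ?_)
  · simp only [EuclideanSpace.norm_sq_eq, Real.norm_eq_abs, sq_abs]
    exact Finset.sum_congr rfl fun i _ => sq _
  · simp only [PiLp.inner_apply, RCLike.inner_apply, conj_trivial, Finset.mul_sum]
    exact Finset.sum_congr rfl fun i _ => by ring

theorem continuous_of_norm_sub_le {E F : Type*} [NormedAddCommGroup E] [NormedAddCommGroup F]
    {h : E → F} {L : ℝ} (hL : ∀ x z, ‖h x - h z‖ ≤ L * ‖x - z‖) : Continuous h :=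
  (LipschitzWith.of_dist_le_mul (K := L.toNNReal) fun x z => by
    rw [dist_eq_norm, dist_eq_norm]
    exact (hL x z).trans
      (mul_le_mul_of_nonneg_right (Real.le_coe_toNNReal L) (norm_nonneg _))).continuous

section Existence

variable {d : ℕ} {U : Type*} [NormedAddCommGroup U] [NormedSpace ℝ U]
  {g₀ : EuclideanSpace ℝ (Fin d) → EuclideanSpace ℝ (Fin d)}
  {g : EuclideanSpace ℝ (Fin d) → U →L[ℝ] EuclideanSpace ℝ (Fin d)} {G : ℝ}

/-- A priori bound under one-sided linear growth. -/
theorem one_add_norm_sq_le_of_isSolutionOn {T : ℝ} (hT : 0 ≤ T) (hG : 0 ≤ G)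
    (hgrowth : ∀ x, 2 * inner ℝ x (g₀ x) + ‖g x‖ ^ 2 ≤ G * (1 + ‖x‖ ^ 2))
    {u : ℝ → U} (hu : IntervalIntegrable (fun s => ‖u s‖ ^ 2) volume 0 T)
    {x₀ : EuclideanSpace ℝ (Fin d)} {x : ℝ → EuclideanSpace ℝ (Fin d)}
    (hx : IsSolutionOn T (fun t y => g₀ y + g y (u t)) x₀ x) :
    ∀ t ∈ Icc 0 T, 1 + ‖x t‖ ^ 2 ≤
      (1 + ‖x₀‖ ^ 2) * Real.exp (G * T + ∫ s in (0 : ℝ)..T, ‖u s‖ ^ 2) := by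
  intro t ht
  have h0 : x 0 = x₀ := by simpa using (hx.2 0 ⟨le_rfl, hT⟩).2
  have hP := isPrimitiveOn_norm_sq_of_isSolutionOn hT hx
  have ha : IntervalIntegrable (fun s => G + ‖u s‖ ^ 2) volume 0 T :=
    intervalIntegrable_const.add hu
  have hφ : ContinuousOn (fun t => 1 + ‖x t‖ ^ 2) (Icc 0 T) :=
    continuousOn_const.add (hx.1.norm.pow 2)
  have haφ : IntervalIntegrable (fun s => (G + ‖u s‖ ^ 2) * (1 + ‖x s‖ ^ 2)) volume 0 T :=
    ha.mul_continuousOn (by rwa [uIcc_of_le hT])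
  refine (le_mul_exp_of_le_add_integral (c := 1 + ‖x₀‖ ^ 2) hT ha (fun t _ => by positivity) hφ
    (fun t ht => ?_) t ht).trans ?_
  · have h1 := hP.2 t ht
    simp only [h0] at h1
    rw [h1, add_assoc]
    gcongr
    refine intervalIntegral.integral_mono_on ht.1 (intervalIntegrable_of_mem_Icc hP.1 ht)
      (intervalIntegrable_of_mem_Icc haφ ht) fun s hs => ?_
    have h2 := hgrowth (x s)
    have h3 : inner ℝ (x s) (g (x s) (u s)) ≤ ‖x s‖ * (‖g (x s)‖ * ‖u s‖) :=
      (real_inner_le_norm _ _).trans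
        (mul_le_mul_of_nonneg_left ((g (x s)).le_opNorm _) (norm_nonneg _))
    rw [inner_add_right]
    -- Young's inequality 2‖x‖‖g‖‖u‖ ≤ ‖g‖² + ‖x‖²‖u‖²: the term ‖g‖² is the one in the growth
    -- condition.
    nlinarith [sq_nonneg (‖g (x s)‖ - ‖x s‖ * ‖u s‖), sq_nonneg ‖u s‖]
  · refine mul_le_mul_of_nonneg_left (Real.exp_le_exp.2 ?_) (by positivity)
    rw [intervalIntegral.integral_add intervalIntegrable_const
      (intervalIntegrable_of_mem_Icc hu ht), intervalIntegral.integral_const, sub_zero,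
      smul_eq_mul, mul_comm]
    refine add_le_add (mul_le_mul_of_nonneg_left ht.2 hG) ?_
    exact intervalIntegral.integral_mono_interval le_rfl ht.1 ht.2
      (Eventually.of_forall fun s => by simp only [Pi.zero_apply]; positivity) hu

/-- The radius R of the cutoff is the a priori bound itself. The cut-off equation obeys the same
bound, so its solution stays where the cutoff is 1 and solves the original equation. -/
theorem exists_isSolutionOn_of_growth {T : ℝ} (hT : 0 ≤ T) (hG : 0 ≤ G)
    (hg₀ : LipschitzOnBalls g₀) (hg : LipschitzOnBalls g)
    (hgrowth : ∀ x, 2 * inner ℝ x (g₀ x) + ‖g x‖ ^ 2 ≤ G * (1 + ‖x‖ ^ 2))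
    {u : ℝ → U} (hu : IntervalIntegrable u volume 0 T)
    (hu2 : IntervalIntegrable (fun s => ‖u s‖ ^ 2) volume 0 T) (x₀ : EuclideanSpace ℝ (Fin d)) :
    ∃ x, IsSolutionOn T (fun t y => g₀ y + g y (u t)) x₀ x := by
  set R := (1 + ‖x₀‖ ^ 2) * Real.exp (G * T + ∫ s in (0 : ℝ)..T, ‖u s‖ ^ 2) with hRdef
  have hR : 0 < R := by positivity
  obtain ⟨L₀, hL₀, h₀⟩ := hg₀.ballCutoff_smul hR
  obtain ⟨L₁, hL₁, h₁⟩ := hg.ballCutoff_smul hR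
  obtain ⟨x, hx⟩ := exists_isSolutionOn hT
    (F := fun t y => ballCutoff R y • g₀ y + (ballCutoff R y • g y) (u t))
    (a := fun s => L₀ + L₁ * ‖u s‖)
    (fun x hx => ((continuous_of_norm_sub_le h₀).comp hx).continuousOn.intervalIntegrable.add
      (intervalIntegrable_clm_apply hT ((continuous_of_norm_sub_le h₁).comp hx).continuousOn hu))
    (intervalIntegrable_const.add (hu.norm.const_mul L₁)) (fun s _ => by positivity)
    (fun s _ x z => by
      rw [add_sub_add_comm, ← _root_.sub_apply]
      refine (norm_add_le _ _).trans ?_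
      have h2 := ContinuousLinearMap.le_of_opNorm_le _ (h₁ x z) (u s)
      linarith [h₀ x z]) x₀
  have hbd : ∀ t ∈ Icc 0 T, ‖x t‖ ≤ R := by
    intro t ht
    have h := one_add_norm_sq_le_of_isSolutionOn (g₀ := fun y => ballCutoff R y • g₀ y)
      (g := fun y => ballCutoff R y • g y) hT hG (fun y => ?_) hu2 hx t ht
    · nlinarith [norm_nonneg (x t), sq_nonneg (‖x t‖ - 1)]
    -- The cutoff χ lies in [0,1], so χ² ≤ χ and the growth expression is at most χ G(1 + ‖y‖²);
    -- then G ≥ 0 is used.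
    · rw [inner_smul_right, norm_smul, Real.norm_of_nonneg (ballCutoff_nonneg R y)]
      have h1 := mul_le_mul_of_nonneg_left (hgrowth y) (ballCutoff_nonneg R y)
      have h2 := mul_le_mul_of_nonneg_right (ballCutoff_le_one R y)
        (show 0 ≤ G * (1 + ‖y‖ ^ 2) by positivity)
      have h3 := mul_le_mul_of_nonneg_right (ballCutoff_le_one R y)
        (mul_nonneg (ballCutoff_nonneg R y) (sq_nonneg ‖g y‖))
      nlinarith
  refine ⟨x, hx.congr_field fun s hs => ?_⟩
  simp only [ballCutoff_eq_one (hbd s hs), one_smul]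

/-- On a set of controls with bounded energy, the solution depends on the control in a Lipschitz
continuous way. -/
theorem exists_norm_sub_le_mul_integral {T B : ℝ} (hT : 0 ≤ T) (hG : 0 ≤ G)
    (hg₀ : LipschitzOnBalls g₀) (hg : LipschitzOnBalls g)
    (hgrowth : ∀ x, 2 * inner ℝ x (g₀ x) + ‖g x‖ ^ 2 ≤ G * (1 + ‖x‖ ^ 2))
    (x₀ : EuclideanSpace ℝ (Fin d)) :
    ∃ C, 0 ≤ C ∧ ∀ u v : ℝ → U, IntervalIntegrable u volume 0 T → IntervalIntegrable v volume 0 T →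
      IntervalIntegrable (fun s => ‖u s‖ ^ 2) volume 0 T →
      IntervalIntegrable (fun s => ‖v s‖ ^ 2) volume 0 T →
      ∫ s in (0 : ℝ)..T, ‖u s‖ ^ 2 ≤ B → ∫ s in (0 : ℝ)..T, ‖v s‖ ^ 2 ≤ B →
      ∀ x z, IsSolutionOn T (fun t y => g₀ y + g y (u t)) x₀ x →
      IsSolutionOn T (fun t y => g₀ y + g y (v t)) x₀ z →
      ∀ t ∈ Icc 0 T, ‖x t - z t‖ ≤ C * ∫ s in (0 : ℝ)..T, ‖u s - v s‖ := by
  set R := (1 + ‖x₀‖ ^ 2) * Real.exp (G * T + B) with hRdef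
  have hR : 0 < R := by positivity
  obtain ⟨L₀, hL₀, h₀⟩ := hg₀ _ hR
  obtain ⟨L₁, hL₁, h₁⟩ := hg _ hR
  obtain ⟨M, hM0, hM⟩ := hg.exists_bound hR
  have hL : 0 ≤ max L₀ L₁ := hL₀.le.trans (le_max_left L₀ L₁)
  -- The exponent comes from 1 + ‖u‖ ≤ 2 + ‖u‖², integrated over [0,T].
  refine ⟨M * Real.exp (max L₀ L₁ * (2 * T + B)), by positivity, ?_⟩
  intro u v hu hv hu2 hv2 huB hvB x z hx hz t ht
  have hbd : ∀ (w : ℝ → U) (y : ℝ → EuclideanSpace ℝ (Fin d)),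
      IntervalIntegrable (fun s => ‖w s‖ ^ 2) volume 0 T →
      ∫ s in (0 : ℝ)..T, ‖w s‖ ^ 2 ≤ B →
      IsSolutionOn T (fun t y => g₀ y + g y (w t)) x₀ y → ∀ t ∈ Icc 0 T, ‖y t‖ ≤ R := by
    intro w y hw hwB hy t ht
    have h := one_add_norm_sq_le_of_isSolutionOn hT hG hgrowth hw hy t ht
    have h' : (1 + ‖x₀‖ ^ 2) * Real.exp (G * T + ∫ s in (0 : ℝ)..T, ‖w s‖ ^ 2) ≤ R := by
      rw [hRdef]
      gcongr
    nlinarith [norm_nonneg (y t), sq_nonneg (‖y t‖ - 1)]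
  refine (norm_sub_le_of_isSolutionOn hT hL hM0
    (fun x z hx hz => (h₀ x z hx hz).trans
      (mul_le_mul_of_nonneg_right (le_max_left _ _) (norm_nonneg _)))
    (fun x z hx hz => (h₁ x z hx hz).trans
      (mul_le_mul_of_nonneg_right (le_max_right _ _) (norm_nonneg _)))
    hM hu hv hx hz (hbd u x hu2 huB hx) (hbd v z hv2 hvB hz) t ht).trans ?_
  have hI : 0 ≤ ∫ s in (0 : ℝ)..T, ‖u s - v s‖ :=
    intervalIntegral.integral_nonneg hT fun s _ => norm_nonneg _
  rw [mul_right_comm]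
  refine mul_le_mul_of_nonneg_right (mul_le_mul_of_nonneg_left (Real.exp_le_exp.2 ?_) hM0) hI
  rw [intervalIntegral.integral_const_mul]
  refine mul_le_mul_of_nonneg_left ?_ hL
  have h2 : IntervalIntegrable (fun s => 2 + ‖u s‖ ^ 2) volume 0 T :=
    intervalIntegrable_const.add hu2
  calc ∫ s in (0 : ℝ)..t, (1 + ‖u s‖) ≤ ∫ s in (0 : ℝ)..t, (2 + ‖u s‖ ^ 2) := by
        refine intervalIntegral.integral_mono_on ht.1
          (intervalIntegrable_const.add (intervalIntegrable_of_mem_Icc hu.norm ht))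
          (intervalIntegrable_of_mem_Icc h2 ht) fun s _ => ?_
        nlinarith [sq_nonneg (‖u s‖ - 1)]
    _ ≤ ∫ s in (0 : ℝ)..T, (2 + ‖u s‖ ^ 2) :=
        intervalIntegral.integral_mono_interval le_rfl ht.1 ht.2
          (Eventually.of_forall fun s => by simp only [Pi.zero_apply]; positivity) h2
    _ = 2 * T + ∫ s in (0 : ℝ)..T, ‖u s‖ ^ 2 := by
        rw [intervalIntegral.integral_add intervalIntegrable_const hu2,
          intervalIntegral.integral_const, sub_zero, smul_eq_mul, mul_comm]
    _ ≤ _ := by linarith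

end Existence

/-! ### Iterated integrals and the shuffle identity -/

/-- The iterated integrals over `[0,t]` of a path with velocity `v`. The head of the list is the
letter that is integrated last. -/
noncomputable def iterInt {ι : Type*} (v : ℝ → ι → ℝ) : List ι → ℝ → ℝ
  | [], _ => 1
  | i :: l, t => ∫ s in (0 : ℝ)..t, iterInt v l s * v s i

section IterInt

variable {ι : Type*} {T : ℝ} {v : ℝ → ι → ℝ}

theorem iterInt_cons (v : ℝ → ι → ℝ) (i : ι) (l : List ι) (t : ℝ) :
    iterInt v (i :: l) t = ∫ s in (0 : ℝ)..t, iterInt v l s * v s i := rfl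

theorem iterInt_cons_zero (v : ℝ → ι → ℝ) (i : ι) (l : List ι) : iterInt v (i :: l) 0 = 0 := by
  simp [iterInt_cons]

theorem continuousOn_iterInt (hT : 0 ≤ T) (hv : ∀ i, IntervalIntegrable (v · i) volume 0 T)
    (l : List ι) : ContinuousOn (iterInt v l) (Icc 0 T) := by
  induction l with
  | nil => exact continuousOn_const
  | cons i l ih =>
    exact continuousOn_integral_Icc hT ((hv i).continuousOn_mul (by rwa [uIcc_of_le hT]))

theorem intervalIntegrable_iterInt_mul (hT : 0 ≤ T)
    (hv : ∀ i, IntervalIntegrable (v · i) volume 0 T) (l : List ι) (i : ι) :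
    IntervalIntegrable (fun s => iterInt v l s * v s i) volume 0 T :=
  (hv i).continuousOn_mul (by rw [uIcc_of_le hT]; exact continuousOn_iterInt hT hv l)

theorem isPrimitiveOn_iterInt_cons (hT : 0 ≤ T) (hv : ∀ i, IntervalIntegrable (v · i) volume 0 T)
    (i : ι) (l : List ι) : IsPrimitiveOn T (iterInt v (i :: l)) fun s => iterInt v l s * v s i :=
  ⟨intervalIntegrable_iterInt_mul hT hv l i, fun t _ => by
    rw [iterInt_cons_zero, zero_add, iterInt_cons]⟩

theorem reverse_ofFn_succ {k : ℕ} (w : Fin (k + 1) → ι) :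
    (List.ofFn w).reverse = w (Fin.last k) :: (List.ofFn (Fin.init w)).reverse := by
  rw [List.ofFn_succ', List.concat_eq_append, List.reverse_append]
  rfl

/-- Inner iterated integrals are continuous and X is a primitive of v, so each Stieltjes integral is
a Lebesgue integral. The reversal is due to the last letter of a word being integrated last. -/
theorem iteratedIntegral_eq_iterInt (hv : ∀ i, IntervalIntegrable (v · i) volume 0 T)
    {X : ℝ → ι → ℝ} (hX : ∀ t ∈ Icc 0 T, ∀ i, X t i = ∫ s in (0 : ℝ)..t, v s i) (k : ℕ)
    (w : Fin k → ι) :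
    ∀ t ∈ Icc 0 T, iteratedIntegral X 0 k w t = iterInt v (List.ofFn w).reverse t := by
  induction k with
  | zero =>
    intro t _
    simp [iteratedIntegral, iterInt]
  | succ k ih =>
    intro t ht
    have hvt : ∀ i, IntervalIntegrable (v · i) volume 0 t := fun i =>
      intervalIntegrable_of_mem_Icc (hv i) ht
    have heq : EqOn (fun s => iteratedIntegral X 0 k (Fin.init w) s)
        (iterInt v (List.ofFn (Fin.init w)).reverse) (Icc 0 t) := fun s hs =>
      ih _ s ⟨hs.1, hs.2.trans ht.2⟩
    rw [reverse_ofFn_succ, iterInt_cons, iteratedIntegral,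
      stieltjesIntegral_eq_integral ht.1 ((continuousOn_iterInt ht.1 hvt _).congr heq)
        (hvt (w (Fin.last k))) fun s hs => hX s ⟨hs.1, hs.2.trans ht.2⟩ _]
    refine intervalIntegral.integral_congr fun s hs => ?_
    rw [uIcc_of_le ht.1] at hs
    simp only [heq hs]

/-- The shuffle identity: a product of iterated integrals is a sum of iterated integrals. -/
theorem exists_iterInt_mul_eq_sum (l r : List ι) : ∃ L : List (List ι),
    ∀ (T : ℝ) (v : ℝ → ι → ℝ), 0 ≤ T → (∀ i, IntervalIntegrable (v · i) volume 0 T) →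
      ∀ t ∈ Icc 0 T, iterInt v l t * iterInt v r t = (L.map fun q => iterInt v q t).sum := by
  have hsum : ∀ (L : List (List ι)) (i : ι) (T : ℝ) (v : ℝ → ι → ℝ), 0 ≤ T →
      (∀ i, IntervalIntegrable (v · i) volume 0 T) → ∀ t ∈ Icc 0 T,
      IntervalIntegrable (fun s => (L.map fun q => iterInt v q s).sum * v s i) volume 0 t ∧
      ∫ s in (0 : ℝ)..t, (L.map fun q => iterInt v q s).sum * v s i =
        ((L.map (List.cons i)).map fun q => iterInt v q t).sum := by
    intro L i T v hT hv t ht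
    induction L with
    | nil => simp
    | cons q L ih =>
      have hq := intervalIntegrable_of_mem_Icc (intervalIntegrable_iterInt_mul hT hv q i) ht
      simp only [List.map_cons, List.sum_cons, add_mul]
      refine ⟨hq.add ih.1, ?_⟩
      rw [intervalIntegral.integral_add hq ih.1, ih.2, iterInt_cons]
  induction l generalizing r with
  | nil => exact ⟨[r], fun T v _ _ t _ => by simp [iterInt]⟩
  | cons i l ihl =>
    induction r with
    | nil => exact ⟨[i :: l], fun T v _ _ t _ => by simp [iterInt]⟩
    | cons j r ihr =>
      -- By the product rule, the last integration of a shuffle is that of i, leaving l against jr,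
      -- or that of j, leaving il against r.
      obtain ⟨L₁, h₁⟩ := ihl (j :: r)
      obtain ⟨L₂, h₂⟩ := ihr
      refine ⟨L₁.map (List.cons i) ++ L₂.map (List.cons j), fun T v hT hv t ht => ?_⟩
      have h := ((isPrimitiveOn_iterInt_cons hT hv i l).mul hT
        (isPrimitiveOn_iterInt_cons hT hv j r)).2 t ht
      dsimp only at h
      rw [h, iterInt_cons_zero, zero_mul, zero_add, List.map_append, List.sum_append,
        ← (hsum L₁ i T v hT hv t ht).2, ← (hsum L₂ j T v hT hv t ht).2,
        ← intervalIntegral.integral_add (hsum L₁ i T v hT hv t ht).1 (hsum L₂ j T v hT hv t ht).1]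
      refine intervalIntegral.integral_congr fun s hs => ?_
      rw [uIcc_of_le ht.1] at hs
      have hs' : s ∈ Icc 0 T := ⟨hs.1, hs.2.trans ht.2⟩
      simp only [← h₁ T v hT hv s hs', ← h₂ T v hT hv s hs']
      ring

theorem abs_iterInt_le {B : ℝ} (hB : 0 ≤ B)
    (hv : ∀ i, IntervalIntegrable (v · i) volume 0 T)
    (hvB : ∀ i, ∫ s in (0 : ℝ)..T, |v s i| ≤ B) (l : List ι) :
    ∀ t ∈ Icc 0 T, |iterInt v l t| ≤ B ^ l.length := by
  induction l with
  | nil => simp [iterInt]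
  | cons i l ih =>
    intro t ht
    rw [iterInt_cons, ← Real.norm_eq_abs]
    refine (intervalIntegral.norm_integral_le_of_norm_le ht.1
      (g := fun s => B ^ l.length * |v s i|) (Eventually.of_forall fun s hs => ?_)
      ((intervalIntegrable_of_mem_Icc (hv i).abs ht).const_mul _)).trans ?_
    · rw [norm_mul, Real.norm_eq_abs, Real.norm_eq_abs]
      exact mul_le_mul_of_nonneg_right (ih s ⟨hs.1.le, hs.2.trans ht.2⟩) (abs_nonneg _)
    · rw [intervalIntegral.integral_const_mul, List.length_cons, pow_succ]
      refine mul_le_mul_of_nonneg_left (le_trans ?_ (hvB i)) (by positivity)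
      exact intervalIntegral.integral_mono_interval le_rfl ht.1 ht.2
        (Eventually.of_forall fun s => abs_nonneg _) (hv i).abs

/-- Iterated integrals depend on the velocity in a Lipschitz continuous way, with respect to the
`L¹` norm. -/
theorem exists_abs_iterInt_sub_le {B : ℝ} (hT : 0 ≤ T) (hB : 0 ≤ B) (l : List ι) :
    ∃ C, 0 ≤ C ∧ ∀ (v v' : ℝ → ι → ℝ) (D : ℝ), (∀ i, IntervalIntegrable (v · i) volume 0 T) →
      (∀ i, IntervalIntegrable (v' · i) volume 0 T) →
      (∀ i, ∫ s in (0 : ℝ)..T, |v s i| ≤ B) → (∀ i, ∫ s in (0 : ℝ)..T, |v' s i| ≤ B) → 0 ≤ D →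
      (∀ i, ∫ s in (0 : ℝ)..T, |v s i - v' s i| ≤ D) →
      ∀ t ∈ Icc 0 T, |iterInt v l t - iterInt v' l t| ≤ C * D := by
  induction l with
  | nil => exact ⟨0, le_rfl, by simp [iterInt]⟩
  | cons i l ih =>
    obtain ⟨C, hC, h⟩ := ih
    -- C * B bounds the error of the inner integral against v; B ^ l.length bounds the inner
    -- integral of v', which meets the error of the velocity.
    refine ⟨C * B + B ^ l.length, by positivity, fun v v' D hv hv' hvB hvB' hD hvD t ht => ?_⟩
    rw [iterInt_cons, iterInt_cons, ← intervalIntegral.integral_sub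
      (intervalIntegrable_of_mem_Icc (intervalIntegrable_iterInt_mul hT hv l i) ht)
      (intervalIntegrable_of_mem_Icc (intervalIntegrable_iterInt_mul hT hv' l i) ht),
      ← Real.norm_eq_abs]
    have h1 := (hv i).abs.const_mul (C * D)
    have h2 := ((hv i).sub (hv' i)).abs.const_mul (B ^ l.length)
    have hle : ∀ f : ℝ → ℝ, IntervalIntegrable f volume 0 T →
        ∫ s in (0 : ℝ)..t, |f s| ≤ ∫ s in (0 : ℝ)..T, |f s| := fun f hf =>
      intervalIntegral.integral_mono_interval le_rfl ht.1 ht.2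
        (Eventually.of_forall fun s => abs_nonneg _) hf.abs
    refine (intervalIntegral.norm_integral_le_of_norm_le ht.1
      (g := fun s => C * D * |v s i| + B ^ l.length * |v s i - v' s i|)
      (Eventually.of_forall fun s hs => ?_)
      (intervalIntegrable_of_mem_Icc (h1.add h2) ht)).trans ?_
    · have hs' : s ∈ Icc 0 T := ⟨hs.1.le, hs.2.trans ht.2⟩
      rw [show iterInt v l s * v s i - iterInt v' l s * v' s i =
        (iterInt v l s - iterInt v' l s) * v s i + iterInt v' l s * (v s i - v' s i) by ring]
      refine (norm_add_le _ _).trans ?_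
      rw [norm_mul, norm_mul, Real.norm_eq_abs, Real.norm_eq_abs, Real.norm_eq_abs,
        Real.norm_eq_abs]
      exact add_le_add
        (mul_le_mul_of_nonneg_right (h v v' D hv hv' hvB hvB' hD hvD s hs') (abs_nonneg _))
        (mul_le_mul_of_nonneg_right (abs_iterInt_le hB hv' hvB' l s hs') (abs_nonneg _))
    · rw [intervalIntegral.integral_add (intervalIntegrable_of_mem_Icc h1 ht)
        (intervalIntegrable_of_mem_Icc h2 ht), intervalIntegral.integral_const_mul,
        intervalIntegral.integral_const_mul]
      have h3 := mul_le_mul_of_nonneg_left ((hle _ (hv i)).trans (hvB i)) (mul_nonneg hC hD)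
      have h4 := mul_le_mul_of_nonneg_left ((hle _ ((hv i).sub (hv' i))).trans (hvD i))
        (pow_nonneg hB l.length)
      linarith

end IterInt

/-! ### The moment problem on an interval -/

/-- An integrable function on `[0,t]` with vanishing moments is zero. -/
theorem ae_eq_zero_of_moments_eq_zero {t : ℝ} (ht : 0 ≤ t) {h : ℝ → ℝ}
    (hh : IntervalIntegrable h volume 0 t) (hm : ∀ k : ℕ, ∫ s in (0 : ℝ)..t, s ^ k * h s = 0) :
    ∀ᵐ s, s ∈ Ioc 0 t → h s = 0 := by
  have hpoly : ∀ p : Polynomial ℝ, ∫ s in (0 : ℝ)..t, p.eval s * h s = 0 := by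
    intro p
    induction p using Polynomial.induction_on' with
    | add p q hp hq =>
      simp only [Polynomial.eval_add, add_mul]
      rw [intervalIntegral.integral_add (hh.continuousOn_mul p.continuous.continuousOn)
        (hh.continuousOn_mul q.continuous.continuousOn), hp, hq, add_zero]
    | monomial k a =>
      simp only [Polynomial.eval_monomial, mul_assoc]
      rw [intervalIntegral.integral_const_mul, hm, mul_zero]
  have hcont : ∀ φ : ℝ → ℝ, Continuous φ → ∫ s in (0 : ℝ)..t, φ s * h s = 0 := by
    intro φ hφ
    by_contra hne
    have hI : 0 ≤ ∫ s in (0 : ℝ)..t, |h s| :=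
      intervalIntegral.integral_nonneg ht fun s _ => abs_nonneg _
    set I := ∫ s in (0 : ℝ)..t, |h s|
    -- With this accuracy a nonzero integral J of φh would satisfy |J| ≤ |J| I/(I + 1) < |J|.
    obtain ⟨p, hp⟩ := exists_polynomial_near_of_continuousOn 0 t φ hφ.continuousOn
      (|∫ s in (0 : ℝ)..t, φ s * h s| / (I + 1)) (div_pos (abs_pos.2 hne) (by positivity))
    have heq : ∫ s in (0 : ℝ)..t, φ s * h s = ∫ s in (0 : ℝ)..t, (φ s * h s - p.eval s * h s) := by
      rw [intervalIntegral.integral_sub (hh.continuousOn_mul hφ.continuousOn)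
        (hh.continuousOn_mul p.continuous.continuousOn), hpoly, sub_zero]
    have hle : |∫ s in (0 : ℝ)..t, φ s * h s| ≤
        |∫ s in (0 : ℝ)..t, φ s * h s| / (I + 1) * I := by
      conv_lhs => rw [heq]
      rw [← intervalIntegral.integral_const_mul, ← Real.norm_eq_abs]
      refine intervalIntegral.norm_integral_le_of_norm_le ht (Eventually.of_forall fun s hs => ?_)
        (hh.abs.const_mul _)
      rw [← sub_mul, norm_mul, norm_sub_rev, Real.norm_eq_abs, Real.norm_eq_abs]
      exact mul_le_mul_of_nonneg_right (hp s (Ioc_subset_Icc_self hs)).le (abs_nonneg _)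
    rw [div_mul_eq_mul_div, le_div_iff₀ (by positivity)] at hle
    nlinarith [abs_pos.2 hne]
  have hint : Integrable ((Ioc 0 t).indicator h) :=
    (integrable_indicator_iff measurableSet_Ioc).2 hh.1
  have hae := ae_eq_zero_of_integral_contDiff_smul_eq_zero hint.locallyIntegrable
    fun φ hφ _ => by
      have := hcont φ hφ.continuous
      rw [intervalIntegral.integral_of_le ht, ← integral_indicator measurableSet_Ioc] at this
      refine Eq.trans (integral_congr_ae (Eventually.of_forall fun s => ?_)) this
      by_cases hs : s ∈ Ioc 0 t
      · simp only [indicator_of_mem hs, smul_eq_mul]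
      · simp only [indicator_of_notMem hs, smul_zero]
  filter_upwards [hae] with s hs hst
  rwa [indicator_of_mem hst] at hs

/-! ### Words and the matrices of the bilinear system -/

section Word

variable {ι : Type*} {N : ℕ}

theorem Word.ofFn_injective : Function.Injective fun w : Word ι N => List.ofFn w.2 := by
  rintro ⟨⟨k, hk⟩, w⟩ ⟨⟨l, hl⟩, w'⟩ h
  have hkl : k = l := by simpa using congrArg List.length h
  subst hkl
  have hw : w = w' := List.ofFn_injective h
  rw [hw]

theorem Word.exists_ofFn_eq {l : List ι} (hl : l.length ≤ N) :
    ∃ w : Word ι N, List.ofFn w.2 = l :=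
  ⟨⟨⟨l.length, Nat.lt_succ_of_le hl⟩, l.get⟩, List.ofFn_get l⟩

theorem signatureMatrix_mulVec_nil [Fintype ι] [DecidableEq ι] (i : ι) (S : Word ι N → ℝ)
    (w : Word ι N) (hw : List.ofFn w.2 = []) : (signatureMatrix N i).mulVec S w = 0 := by
  refine Finset.sum_eq_zero fun v _ => ?_
  have h : signatureMatrix N i w v = 0 := if_neg (by simp [hw])
  simp only [h, zero_mul]

/-- A nonempty word has exactly one predecessor and one last letter, so its row has at most one
nonzero entry. -/
theorem signatureMatrix_mulVec_append [Fintype ι] [DecidableEq ι] (i j : ι) (S : Word ι N → ℝ)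
    (w v : Word ι N) (hw : List.ofFn w.2 = List.ofFn v.2 ++ [j]) :
    (signatureMatrix N i).mulVec S w = if i = j then S v else 0 := by
  have hiff : ∀ v' : Word ι N, List.ofFn w.2 = List.ofFn v'.2 ++ [i] ↔ v' = v ∧ i = j := by
    intro v'
    rw [hw]
    constructor
    · intro h
      have h1 := List.append_inj' h rfl
      exact ⟨(Word.ofFn_injective h1.1).symm, by simpa using h1.2.symm⟩
    · rintro ⟨rfl, rfl⟩
      rfl
  simp only [Matrix.mulVec, dotProduct, signatureMatrix, hiff]
  split_ifs with h <;> simp [h]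

end Word

/-- The velocity of the time-extended integrated control. -/
def extendedVelocity {m : ℕ} (u : ℝ → EuclideanSpace ℝ (Fin m)) (t : ℝ) : Fin (m + 1) → ℝ :=
  Fin.cons 1 fun i => u t i

/-! ### The signature of the time-extended path -/

section Signature

variable {m : ℕ} {T : ℝ} {u : ℝ → EuclideanSpace ℝ (Fin m)}

theorem extendedPath_eq_integral (u : ℝ → EuclideanSpace ℝ (Fin m)) (t : ℝ) (i : Fin (m + 1)) :
    extendedPath u t i = ∫ s in (0 : ℝ)..t, extendedVelocity u s i := by
  refine Fin.cases ?_ (fun j => ?_) i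
  · simp [extendedPath, extendedVelocity]
  · simp [extendedPath, extendedVelocity]

theorem intervalIntegrable_extendedVelocity (hu : IntervalIntegrable u volume 0 T)
    (i : Fin (m + 1)) : IntervalIntegrable (extendedVelocity u · i) volume 0 T := by
  refine Fin.cases ?_ (fun j => ?_) i
  · simp [extendedVelocity]
  · simp only [extendedVelocity, Fin.cons_succ]
    exact ⟨(EuclideanSpace.proj j : _ →L[ℝ] ℝ).integrable_comp hu.1,
      (EuclideanSpace.proj j : _ →L[ℝ] ℝ).integrable_comp hu.2⟩

theorem truncatedSignature_eq_iterInt (hu : IntervalIntegrable u volume 0 T) {N : ℕ}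
    (w : Word (Fin (m + 1)) N) {t : ℝ} (ht : t ∈ Icc 0 T) :
    truncatedSignature N (extendedPath u) 0 t w =
      iterInt (extendedVelocity u) (List.ofFn w.2).reverse t :=
  iteratedIntegral_eq_iterInt (intervalIntegrable_extendedVelocity hu)
    (fun t _ i => extendedPath_eq_integral u t i) _ _ t ht

/-- The letter 0 has velocity 1, so the drift is one more term of a sum over all letters, of which
only the last letter of w contributes. -/
theorem bilinearField_append {N : ℕ} (s : ℝ) (S : Word (Fin (m + 1)) N → ℝ)
    (w v : Word (Fin (m + 1)) N) (j : Fin (m + 1)) (hw : List.ofFn w.2 = List.ofFn v.2 ++ [j]) :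
    bilinearField N u s S w = S v * extendedVelocity u s j := by
  have h : bilinearField N u s S w =
      ∑ i, extendedVelocity u s i * (signatureMatrix N i).mulVec S w := by
    simp [bilinearField, Fin.sum_univ_succ, extendedVelocity, Finset.sum_apply]
  rw [h]
  simp only [signatureMatrix_mulVec_append _ j S w v hw]
  simp [mul_comm]

theorem bilinearField_nil {N : ℕ} (s : ℝ) (S : Word (Fin (m + 1)) N → ℝ)
    (w : Word (Fin (m + 1)) N) (hw : List.ofFn w.2 = []) : bilinearField N u s S w = 0 := by
  simp [bilinearField, Finset.sum_apply, signatureMatrix_mulVec_nil _ S w hw]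

/-- The truncated signature solves the bilinear system. -/
theorem isSolutionOn_truncatedSignature (hT : 0 ≤ T) (hu : IntervalIntegrable u volume 0 T)
    (N : ℕ) :
    IsSolutionOn T (bilinearField N u) (Pi.single (emptyWord (Fin (m + 1)) N) 1)
      (fun t => truncatedSignature N (extendedPath u) 0 t) := by
  have hv := intervalIntegrable_extendedVelocity hu
  have hcomp : ∀ w : Word (Fin (m + 1)) N, ∀ t ∈ Icc 0 T,
      IntervalIntegrable (fun s =>
        bilinearField N u s (truncatedSignature N (extendedPath u) 0 s) w) volume 0 t ∧
      truncatedSignature N (extendedPath u) 0 t w =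
        (Pi.single (emptyWord (Fin (m + 1)) N) 1 : Word (Fin (m + 1)) N → ℝ) w +
        ∫ s in (0 : ℝ)..t, bilinearField N u s (truncatedSignature N (extendedPath u) 0 s) w := by
    intro w t ht
    have hsingle : (Pi.single (emptyWord (Fin (m + 1)) N) 1 : Word (Fin (m + 1)) N → ℝ) w =
        if List.ofFn w.2 = [] then 1 else 0 := by
      rw [Pi.single_apply]
      refine if_congr ⟨?_, fun h => Word.ofFn_injective (h.trans ?_)⟩ rfl rfl
      · rintro rfl
        exact List.ofFn_zero
      · exact List.ofFn_zero.symm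
    rw [hsingle]
    rcases w with ⟨⟨_ | k, hk⟩, w⟩
    · have hnil : List.ofFn w = [] := List.ofFn_zero
      -- The entry of the empty word is constantly 1 and its equation has right-hand side 0.
      simp only [bilinearField_nil _ _ (⟨⟨0, hk⟩, w⟩ : Word (Fin (m + 1)) N) hnil]
      rw [truncatedSignature_eq_iterInt hu _ ht, if_pos hnil]
      dsimp only
      rw [hnil]
      simp [iterInt]
    · have hw : List.ofFn w = List.ofFn (Fin.init w) ++ [w (Fin.last k)] := by
        rw [List.ofFn_succ', List.concat_eq_append]
        rfl
      have hfield : ∀ s ∈ Icc 0 T, bilinearField N u s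
          (truncatedSignature N (extendedPath u) 0 s) ⟨⟨k + 1, hk⟩, w⟩ =
          iterInt (extendedVelocity u) (List.ofFn (Fin.init w)).reverse s *
            extendedVelocity u s (w (Fin.last k)) := by
        intro s hs
        rw [bilinearField_append s _ ⟨⟨k + 1, hk⟩, w⟩ ⟨⟨k, by omega⟩, Fin.init w⟩ _ hw,
          truncatedSignature_eq_iterInt hu _ hs]
      have hint := intervalIntegrable_iterInt_mul hT hv (List.ofFn (Fin.init w)).reverse
        (w (Fin.last k))
      constructor
      · refine (intervalIntegrable_of_mem_Icc hint ht).congr fun s hs => ?_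
        rw [uIoc_of_le ht.1] at hs
        exact (hfield s ⟨hs.1.le, hs.2.trans ht.2⟩).symm
      · rw [truncatedSignature_eq_iterInt hu _ ht, if_neg (by simp)]
        dsimp only
        rw [reverse_ofFn_succ, iterInt_cons, zero_add]
        refine intervalIntegral.integral_congr fun s hs => ?_
        rw [uIcc_of_le ht.1] at hs
        exact (hfield s ⟨hs.1, hs.2.trans ht.2⟩).symm
  refine ⟨?_, fun t ht => ⟨?_, ?_⟩⟩
  · exact continuousOn_pi.2 fun w => (continuousOn_iterInt hT hv _).congr
      fun t ht => truncatedSignature_eq_iterInt hu w ht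
  · exact ⟨Integrable.of_eval fun w => (hcomp w t ht).1.1,
      Integrable.of_eval fun w => (hcomp w t ht).1.2⟩
  · ext w
    dsimp only
    rw [(hcomp w t ht).2, Pi.add_apply, intervalIntegral.integral_of_le ht.1,
      intervalIntegral.integral_of_le ht.1, eval_integral fun w => (hcomp w t ht).1.1]

theorem iterInt_replicate_zero (u : ℝ → EuclideanSpace ℝ (Fin m)) (k : ℕ) (t : ℝ) :
    iterInt (extendedVelocity u) (List.replicate k 0) t = t ^ k / k.factorial := by
  induction k generalizing t with
  | zero => simp [iterInt]
  | succ k ih =>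
    rw [List.replicate_succ, iterInt_cons]
    simp only [ih, extendedVelocity, Fin.cons_zero, mul_one]
    rw [intervalIntegral.integral_div, integral_pow, Nat.factorial_succ]
    push_cast
    field_simp
    simp

/-- The signature of the time-extended path determines the time and the control up to that time. -/
theorem eq_of_iterInt_extendedVelocity_eq {v : ℝ → EuclideanSpace ℝ (Fin m)}
    (hu : IntervalIntegrable u volume 0 T) (hv : IntervalIntegrable v volume 0 T) {t s : ℝ}
    (ht : t ∈ Icc 0 T)
    (h : ∀ l, iterInt (extendedVelocity u) l t = iterInt (extendedVelocity v) l s) :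
    t = s ∧ ∀ᵐ r, r ∈ Ioc 0 t → u r = v r := by
  have hts : t = s := by
    -- The word 0 reads off the time.
    have h1 := h (List.replicate 1 0)
    rw [iterInt_replicate_zero, iterInt_replicate_zero] at h1
    simpa using h1
  subst hts
  refine ⟨rfl, ?_⟩
  have hcomp : ∀ i : Fin m, ∀ᵐ r, r ∈ Ioc 0 t → u r i - v r i = 0 := by
    intro i
    have hui : IntervalIntegrable (fun r => u r i) volume 0 t := by
      simpa [extendedVelocity] using
        intervalIntegrable_of_mem_Icc (intervalIntegrable_extendedVelocity hu i.succ) ht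
    have hvi : IntervalIntegrable (fun r => v r i) volume 0 t := by
      simpa [extendedVelocity] using
        intervalIntegrable_of_mem_Icc (intervalIntegrable_extendedVelocity hv i.succ) ht
    refine ae_eq_zero_of_moments_eq_zero ht.1 (hui.sub hvi) fun k => ?_
    -- This entry is the k-th moment of the i-th control component on [0,t], divided by k!.
    have hk := h (i.succ :: List.replicate k 0)
    simp only [iterInt_cons, iterInt_replicate_zero, extendedVelocity, Fin.cons_succ,
      div_mul_eq_mul_div, intervalIntegral.integral_div] at hk
    rw [div_left_inj' (by positivity)] at hk
    simp only [mul_sub]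
    rw [intervalIntegral.integral_sub (hui.continuousOn_mul (by fun_prop))
      (hvi.continuousOn_mul (by fun_prop)), hk, sub_self]
  filter_upwards [ae_all_iff.2 hcomp] with r hr hrt
  ext i
  exact sub_eq_zero.1 (hr i hrt)

end Signature

/-! ### Stone–Weierstrass on the image of the signature map -/

/-- Stone–Weierstrass for functions that factor through a family of continuous functions whose
linear span is closed under multiplication. -/
theorem exists_finsupp_abs_sub_lt {Z Λ : Type*} [TopologicalSpace Z] [CompactSpace Z]
    {S : Z → Λ → ℝ} (hS : ∀ l, Continuous fun z => S z l)
    (hmul : ∀ l r, ∃ L : List Λ, ∀ z, S z l * S z r = (L.map (S z)).sum)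
    (hone : ∃ e, ∀ z, S z e = 1) {y : Z → ℝ} (hy : Continuous y)
    (hfac : ∀ z z', S z = S z' → y z = y z') {ε : ℝ} (hε : 0 < ε) :
    ∃ ℓ : Λ →₀ ℝ, ∀ z, |y z - ℓ.sum fun l a => a * S z l| < ε := by
  have hSc : Continuous S := continuous_pi hS
  -- S need not be injective, so the coordinates may fail to separate points of Z. They do separate
  -- points of the compact range of S.
  have hcomp : CompactSpace (range S) := isCompact_iff_compactSpace.1 (isCompact_range hSc)
  let coord : Λ → C(range S, ℝ) := fun l =>
    ⟨fun q => q.1 l, (continuous_apply l).comp continuous_subtype_val⟩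
  let P : Submodule ℝ C(range S, ℝ) := Submodule.span ℝ (range coord)
  have hP1 : (1 : C(range S, ℝ)) ∈ P := by
    obtain ⟨e, he⟩ := hone
    refine Submodule.subset_span ⟨e, ?_⟩
    ext ⟨_, z, rfl⟩
    exact he z
  have hPmul : ∀ a b, a ∈ P → b ∈ P → a * b ∈ P := by
    intro a b ha hb
    have hle : P * P ≤ P := by
      rw [Submodule.span_mul_span, Submodule.span_le]
      rintro _ ⟨_, ⟨l, rfl⟩, _, ⟨r, rfl⟩, rfl⟩
      obtain ⟨L, hL⟩ := hmul l r
      have heq : coord l * coord r = (L.map coord).sum := by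
        have haux : ∀ (L : List Λ) (q : range S), (L.map coord).sum q = (L.map q.1).sum := by
          intro L q
          induction L with
          | nil => rfl
          | cons i L ih => simp [ih, coord]
        ext ⟨_, z, rfl⟩
        rw [haux]
        exact hL z
      change coord l * coord r ∈ P
      rw [heq]
      refine list_sum_mem fun q hq => ?_
      obtain ⟨i, _, rfl⟩ := List.mem_map.1 hq
      exact Submodule.subset_span ⟨i, rfl⟩
    exact hle (Submodule.mul_mem_mul ha hb)
  let A : Subalgebra ℝ C(range S, ℝ) := P.toSubalgebra hP1 hPmul
  have hsep : A.SeparatesPoints := by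
    intro q q' hne
    obtain ⟨l, hl⟩ := Function.ne_iff.1 (fun h => hne (Subtype.ext h) : q.1 ≠ q'.1)
    exact ⟨coord l, ⟨coord l, Submodule.subset_span ⟨l, rfl⟩, rfl⟩, hl⟩
  let π : C(Z, range S) := ⟨rangeFactorization S, hSc.subtype_mk _⟩
  -- A continuous surjection from a compact space onto a Hausdorff space is a quotient map, so y
  -- descends to a continuous function on the range.
  have hπ : IsQuotientMap π :=
    IsQuotientMap.of_surjective_continuous rangeFactorization_surjective π.continuous
  let Y : C(range S, ℝ) := hπ.lift ⟨y, hy⟩ fun z z' h => hfac z z' (congrArg Subtype.val h)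
  have hY : ∀ z, Y (π z) = y z := fun z =>
    DFunLike.congr_fun (hπ.lift_comp ⟨y, hy⟩
      fun z z' h => hfac z z' (congrArg Subtype.val h)) z
  obtain ⟨⟨g, hg⟩, hgY⟩ :=
    ContinuousMap.exists_mem_subalgebra_near_continuousMap_of_separatesPoints A hsep Y ε hε
  obtain ⟨ℓ, rfl⟩ := Finsupp.mem_span_range_iff_exists_finsupp.1 (show g ∈ P from hg)
  refine ⟨ℓ, fun z => ?_⟩
  have hz := (ContinuousMap.norm_coe_le_norm (_ - Y) (π z)).trans_lt hgY
  rw [ContinuousMap.sub_apply, hY, norm_sub_rev, Real.norm_eq_abs] at hz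
  have hval : (ℓ.sum fun l a => a • coord l) (π z) = ℓ.sum fun l a => a * S z l := by
    simp only [Finsupp.sum, ContinuousMap.sum_apply, ContinuousMap.smul_apply, smul_eq_mul]
    rfl
  rwa [← hval]

/-- Reversal identifies words with lists of length at most N; those outside the support of ℓ
contribute nothing. This turns the combination found by Stone–Weierstrass into a matrix row. -/
theorem sum_word_eq_finsupp_sum {ι : Type*} [Fintype ι] {N : ℕ} (ℓ : List ι →₀ ℝ)
    (hℓ : ∀ l ∈ ℓ.support, l.length ≤ N) (g : List ι → ℝ) :
    ∑ w : Word ι N, ℓ (List.ofFn w.2).reverse * g (List.ofFn w.2).reverse =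
      ℓ.sum fun l a => a * g l := by
  classical
  have hinj : Function.Injective fun w : Word ι N => (List.ofFn w.2).reverse := fun w w' h =>
    Word.ofFn_injective (List.reverse_injective h)
  rw [Finsupp.sum, ← Finset.sum_image (f := fun l => ℓ l * g l) (s := Finset.univ)
    (fun w _ w' _ h => hinj h)]
  refine (Finset.sum_subset (fun l hl => ?_) fun l _ hl => ?_).symm
  · obtain ⟨w, hw⟩ := Word.exists_ofFn_eq (N := N) (l := l.reverse)
      (by rw [List.length_reverse]; exact hℓ l hl)
    exact Finset.mem_image.2 ⟨w, Finset.mem_univ _, by rw [hw, List.reverse_reverse]⟩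
  · rw [Finsupp.notMem_support_iff.1 hl, zero_mul]

/-! ### Square-integrable controls -/

section Control

variable {T : ℝ} {m : ℕ}

theorem Control.intervalIntegrable (hT : 0 ≤ T) (u : Control T m) :
    IntervalIntegrable u volume 0 T :=
  (intervalIntegrable_iff_integrableOn_Icc_of_le hT).2 ((Lp.memLp u).integrable one_le_two)

theorem Control.intervalIntegrable_norm_sq (hT : 0 ≤ T) (u : Control T m) :
    IntervalIntegrable (fun s => ‖u s‖ ^ 2) volume 0 T :=
  (intervalIntegrable_iff_integrableOn_Icc_of_le hT).2
    ((memLp_two_iff_integrable_sq_norm (Lp.aestronglyMeasurable u)).1 (Lp.memLp u))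

theorem Control.integral_norm_sq (hT : 0 ≤ T) (u : Control T m) :
    ∫ s in (0 : ℝ)..T, ‖u s‖ ^ 2 = ‖u‖ ^ 2 := by
  rw [intervalIntegral.integral_of_le hT, ← integral_Icc_eq_integral_Ioc,
    ← real_inner_self_eq_norm_sq, L2.inner_def]
  simp only [real_inner_self_eq_norm_sq]

theorem Control.exists_integral_norm_sub_le (hT : 0 ≤ T) :
    ∃ C, 0 ≤ C ∧ ∀ u v : Control T m, ∫ s in (0 : ℝ)..T, ‖u s - v s‖ ≤ C * ‖u - v‖ := by
  -- Hölder's inequality on [0,T]: the constant is the square root of T, as a power of the total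
  -- mass.
  refine ⟨(volume.restrict (Icc (0 : ℝ) T) univ ^ (1 / (1 : ℝ≥0∞).toReal -
    1 / (2 : ℝ≥0∞).toReal)).toReal, ENNReal.toReal_nonneg, fun u v => ?_⟩
  have h1 : ∫ s in (0 : ℝ)..T, ‖u s - v s‖ = ∫ s in Icc 0 T, ‖(u - v) s‖ := by
    rw [intervalIntegral.integral_of_le hT, ← integral_Icc_eq_integral_Ioc]
    refine integral_congr_ae ?_
    filter_upwards [Lp.coeFn_sub u v] with s hs
    rw [hs, Pi.sub_apply]
  rw [h1, integral_norm_eq_lintegral_enorm (Lp.aestronglyMeasurable _),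
    ← eLpNorm_one_eq_lintegral_enorm, Lp.norm_def, mul_comm, ← ENNReal.toReal_mul]
  refine ENNReal.toReal_mono (ENNReal.mul_ne_top (Lp.eLpNorm_ne_top _) ?_)
    (eLpNorm_le_eLpNorm_mul_rpow_measure_univ one_le_two (Lp.aestronglyMeasurable _))
  refine ENNReal.rpow_ne_top_of_nonneg (by norm_num) (measure_ne_top _ _)

/-- Iterated integrals of the time-extended path are jointly continuous in the time and the
control, on bounded sets of controls. -/
theorem continuousOn_iterInt_extendedVelocity (hT : 0 ≤ T) {K : Set (Control T m)}
    (hK : Bornology.IsBounded K) (l : List (Fin (m + 1))) :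
    ContinuousOn (fun z : ℝ × Control T m => iterInt (extendedVelocity z.2) l z.1)
      (Icc 0 T ×ˢ K) := by
  obtain ⟨ρ, hρ0, hρ⟩ := hK.exists_pos_norm_le
  obtain ⟨C, hC0, hC⟩ := Control.exists_integral_norm_sub_le (m := m) hT
  -- T bounds the L¹ norm of the velocity of time and C * ρ that of each control component.
  obtain ⟨C₁, hC₁0, hC₁⟩ := exists_abs_iterInt_sub_le (ι := Fin (m + 1)) hT
    (B := T + C * ρ) (by positivity) l
  have hint := fun u : Control T m => intervalIntegrable_extendedVelocity
    (Control.intervalIntegrable hT u)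
  have hdiff : ∀ (u v : Control T m) (i : Fin (m + 1)),
      ∫ s in (0 : ℝ)..T, |extendedVelocity u s i - extendedVelocity v s i| ≤ C * ‖u - v‖ := by
    intro u v i
    refine le_trans (intervalIntegral.integral_mono_on hT ((hint u i).sub (hint v i)).abs
      ((Control.intervalIntegrable hT u).sub (Control.intervalIntegrable hT v)).norm
      fun s _ => ?_) (hC u v)
    refine Fin.cases ?_ (fun j => ?_) i
    · simp [extendedVelocity]
    · simpa [extendedVelocity] using PiLp.norm_apply_le (u s - v s) j
  have hbd : ∀ u ∈ K, ∀ i, ∫ s in (0 : ℝ)..T, |extendedVelocity u s i| ≤ T + C * ρ := by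
    intro u hu i
    have h0 : ∫ s in (0 : ℝ)..T, ‖u s‖ ≤ C * ρ := by
      have h := hC u 0
      rw [sub_zero] at h
      refine le_trans (le_of_eq ?_) (h.trans (mul_le_mul_of_nonneg_left (hρ u hu) hC0))
      rw [intervalIntegral.integral_of_le hT, intervalIntegral.integral_of_le hT,
        ← integral_Icc_eq_integral_Ioc, ← integral_Icc_eq_integral_Ioc]
      refine integral_congr_ae ?_
      filter_upwards [Lp.coeFn_zero (EuclideanSpace ℝ (Fin m)) 2
        (volume.restrict (Icc (0 : ℝ) T))] with s hs
      rw [hs, Pi.zero_apply, sub_zero]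
    refine Fin.cases ?_ (fun j => ?_) i
    · simp only [extendedVelocity, Fin.cons_zero, abs_one, intervalIntegral.integral_const,
        sub_zero, smul_eq_mul, mul_one]
      have : 0 ≤ C * ρ := by positivity
      linarith
    · refine le_trans (intervalIntegral.integral_mono_on hT (hint u j.succ).abs
        (Control.intervalIntegrable hT u).norm fun s _ => ?_) (h0.trans (by linarith))
      simpa [extendedVelocity] using PiLp.norm_apply_le (u s) j
  -- Continuity in time and a Lipschitz bound in the control that is uniform in time give joint
  -- continuity.
  refine continuousOn_prod_of_continuousOn_lipschitzOnWith' _ (C₁ * C).toNNReal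
    (fun t ht => LipschitzOnWith.of_dist_le_mul fun u hu v hv => ?_)
    fun u hu => continuousOn_iterInt hT (hint u) l
  rw [Real.dist_eq, dist_eq_norm, Real.coe_toNNReal _ (by positivity), mul_assoc]
  exact hC₁ _ _ _ (hint u) (hint v) (hbd u hu) (hbd v hv) (by positivity) (hdiff u v) t ht

end Control

/-! ### Matrix norms, the approximation and the theorem -/

/-- The operator norm of a matrix is bounded by its Frobenius norm. -/
theorem norm_toEuclideanLin_le_frobenius {d m : ℕ} (M : Matrix (Fin d) (Fin m) ℝ) :
    ‖LinearMap.toContinuousLinearMap M.toEuclideanLin‖ ≤ ‖M‖ := by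
  refine ContinuousLinearMap.opNorm_le_bound _ (norm_nonneg M) fun v => ?_
  have hM : ‖M‖ ^ 2 = ∑ i, ∑ j, M i j ^ 2 := by
    rw [Matrix.frobenius_norm_def, ← Real.sqrt_eq_rpow, Real.sq_sqrt (by positivity)]
    simp
  rw [← pow_le_pow_iff_left₀ (norm_nonneg _) (by positivity) two_ne_zero, mul_pow, hM,
    EuclideanSpace.norm_sq_eq, EuclideanSpace.norm_sq_eq, Finset.sum_mul]
  refine Finset.sum_le_sum fun i _ => ?_
  simp only [Real.norm_eq_abs, sq_abs]
  exact Finset.sum_mul_sq_le_sq_mul_sq Finset.univ (M i) v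

theorem lipschitzOnBalls_toEuclideanLin {d m : ℕ} {E : Type*} [NormedAddCommGroup E]
    {f : E → Matrix (Fin d) (Fin m) ℝ} (hf : LipschitzOnBalls f) :
    LipschitzOnBalls fun x => LinearMap.toContinuousLinearMap (f x).toEuclideanLin := by
  intro R hR
  obtain ⟨L, hL, h⟩ := hf R hR
  refine ⟨L, hL, fun x z hx hz => le_trans ?_ (h x z hx hz)⟩
  rw [← map_sub, ← map_sub]
  exact norm_toEuclideanLin_le_frobenius _

theorem EuclideanSpace.norm_le_of_abs_le {p : ℕ} (x : EuclideanSpace ℝ (Fin p)) {η : ℝ}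
    (hη : 0 ≤ η) (hx : ∀ j, |x j| ≤ η) : ‖x‖ ≤ (p + 1) * η := by
  rw [← pow_le_pow_iff_left₀ (norm_nonneg _) (by positivity) two_ne_zero,
    EuclideanSpace.norm_sq_eq]
  calc ∑ j, ‖x j‖ ^ 2 ≤ ∑ _j : Fin p, η ^ 2 :=
        Finset.sum_le_sum fun j _ => pow_le_pow_left₀ (norm_nonneg _) (hx j) 2
    _ = p * η ^ 2 := by simp
    _ ≤ ((p + 1) * η) ^ 2 := by
        rw [mul_pow]
        have hp : (0 : ℝ) ≤ p := Nat.cast_nonneg p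
        exact mul_le_mul_of_nonneg_right (by nlinarith) (sq_nonneg η)

/-- A function of the time and the control that is continuous on a compact set and only depends on
the control up to the time is a uniform limit of linear functions of the signature. -/
theorem exists_matrix_norm_sub_mulVec_lt {T : ℝ} (hT : 0 ≤ T) {m p : ℕ} {K : Set (Control T m)}
    (hK : IsCompact K) {y : ℝ × Control T m → EuclideanSpace ℝ (Fin p)}
    (hy : ContinuousOn y (Icc 0 T ×ˢ K))
    (hcausal : ∀ t ∈ Icc 0 T, ∀ u ∈ K, ∀ v ∈ K, (∀ᵐ s, s ∈ Ioc 0 t → u s = v s) →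
      y (t, u) = y (t, v)) {ε : ℝ} (hε : 0 < ε) :
    ∃ (N : ℕ) (C : Matrix (Fin p) (Word (Fin (m + 1)) N) ℝ), ∀ t ∈ Icc 0 T, ∀ u ∈ K,
      ‖y (t, u) - WithLp.toLp 2 (C.mulVec (truncatedSignature N (extendedPath u) 0 t))‖ ≤ ε := by
  let Z := (Icc 0 T ×ˢ K : Set (ℝ × Control T m))
  have hZ : CompactSpace Z := isCompact_iff_compactSpace.1 (isCompact_Icc.prod hK)
  let S : Z → List (Fin (m + 1)) → ℝ := fun z l => iterInt (extendedVelocity z.1.2) l z.1.1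
  have hint := fun u : Control T m => Control.intervalIntegrable hT u
  have happrox : ∀ j : Fin p, ∃ ℓ : List (Fin (m + 1)) →₀ ℝ, ∀ z : Z,
      |y z j - ℓ.sum fun l a => a * S z l| < ε / (p + 1) := by
    intro j
    refine exists_finsupp_abs_sub_lt (S := S) (fun l => ?_) (fun l r => ?_) ⟨[], fun _ => rfl⟩
      ?_ (fun z z' h => ?_) (by positivity)
    · exact continuousOn_iff_continuous_domRestrict.1
        (continuousOn_iterInt_extendedVelocity hT hK.isBounded l)
    · obtain ⟨L, hL⟩ := exists_iterInt_mul_eq_sum l r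
      exact ⟨L, fun z => hL T _ hT (intervalIntegrable_extendedVelocity (hint z.1.2)) _ z.2.1⟩
    · exact (EuclideanSpace.proj j : _ →L[ℝ] ℝ).continuous.comp
        (continuousOn_iff_continuous_domRestrict.1 hy)
    · obtain ⟨⟨t, u⟩, ht, hu⟩ := z
      obtain ⟨⟨s, v⟩, hs, hv⟩ := z'
      obtain ⟨rfl, huv⟩ := eq_of_iterInt_extendedVelocity_eq (hint u) (hint v) ht
        fun l => congrFun h l
      exact congrArg (fun w : EuclideanSpace ℝ (Fin p) => w j) (hcausal _ ht u hu v hv huv)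
  choose ℓ hℓ using happrox
  -- Finitely many words occur for each of the p components, so one order serves them all.
  let N := Finset.univ.sup fun j => (ℓ j).support.sup List.length
  refine ⟨N, Matrix.of fun j w => ℓ j (List.ofFn w.2).reverse, fun t ht u hu => ?_⟩
  refine (EuclideanSpace.norm_le_of_abs_le _ (η := ε / (p + 1)) (by positivity)
    fun j => ?_).trans (le_of_eq (by field_simp))
  have h := hℓ j ⟨(t, u), ht, hu⟩
  rw [← sum_word_eq_finsupp_sum (N := N) (ℓ j)
    fun l hl => (Finset.le_sup (f := List.length) hl).trans
      (Finset.le_sup (f := fun j => (ℓ j).support.sup List.length) (Finset.mem_univ j))] at h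
  have hval : Matrix.mulVec (Matrix.of fun j (w : Word (Fin (m + 1)) N) =>
      ℓ j (List.ofFn w.2).reverse) (truncatedSignature N (extendedPath u) 0 t) j =
      ∑ w : Word (Fin (m + 1)) N, ℓ j (List.ofFn w.2).reverse *
        S ⟨(t, u), ht, hu⟩ (List.ofFn w.2).reverse :=
    Finset.sum_congr rfl fun w _ =>
      congrArg (ℓ j (List.ofFn w.2).reverse * ·) (truncatedSignature_eq_iterInt (hint u) w ht)
  rw [← hval] at h
  exact h.le

/-- The conclusion has three parts: the controlled equation has exactly one solution on `[0,T]` for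
every control in `L²`; its output is approximated, uniformly in time and over the compact set `K`
of controls, by a linear image of a truncated signature (the supremum is taken in `[0,∞]`); and the
truncated signatures solve a bilinear control system that does not depend on the equation. -/
theorem corollary3p7 (d m p : ℕ) (T : ℝ) (hT : 0 < T)
    (f₀ : EuclideanSpace ℝ (Fin d) → EuclideanSpace ℝ (Fin d))
    (f : EuclideanSpace ℝ (Fin d) → Matrix (Fin d) (Fin m) ℝ)
    (c : EuclideanSpace ℝ (Fin d) → EuclideanSpace ℝ (Fin p))
    (x₀ : EuclideanSpace ℝ (Fin d))
    (hf₀ : LipschitzOnBalls f₀) (hf : LipschitzOnBalls f) (hc : LipschitzOnBalls c)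
    (hgrowth : ∃ G : ℝ, ∀ x, 2 * inner ℝ x (f₀ x) + ‖f x‖ ^ 2 ≤ G * (1 + ‖x‖ ^ 2))
    (K : Set (Control T m)) (hK : IsCompact K) :
    (∀ u : Control T m, ∃ x : ℝ → EuclideanSpace ℝ (Fin d),
      IsSolutionOn T (controlledField f₀ f u) x₀ x ∧
        ∀ z, IsSolutionOn T (controlledField f₀ f u) x₀ z → EqOn z x (Icc 0 T)) ∧
    (∀ x : Control T m → ℝ → EuclideanSpace ℝ (Fin d),
      (∀ u ∈ K, IsSolutionOn T (controlledField f₀ f u) x₀ (x u)) →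
      ∀ ε : ℝ, 0 < ε → ∃ (N : ℕ) (C : Matrix (Fin p) (Word (Fin (m + 1)) N) ℝ),
        ⨆ t ∈ Icc 0 T, ⨆ u ∈ K,
          ‖c (x u t) - WithLp.toLp 2 (C.mulVec (truncatedSignature N (extendedPath u) 0 t))‖ₑ
            < ENNReal.ofReal ε) ∧
    (∀ (N : ℕ) (u : Control T m),
      IsSolutionOn T (bilinearField N u) (Pi.single (emptyWord (Fin (m + 1)) N) 1)
        (fun t => truncatedSignature N (extendedPath u) 0 t)) := by
  obtain ⟨G, hG⟩ := hgrowth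
  let g : EuclideanSpace ℝ (Fin d) → EuclideanSpace ℝ (Fin m) →L[ℝ] EuclideanSpace ℝ (Fin d) :=
    fun x => LinearMap.toContinuousLinearMap (f x).toEuclideanLin
  have hg : LipschitzOnBalls g := lipschitzOnBalls_toEuclideanLin hf
  -- G may be negative; the a priori bound needs a nonnegative constant.
  have hG0 : 0 ≤ max G 0 := le_max_right _ _
  have hgr : ∀ x, 2 * inner ℝ x (f₀ x) + ‖g x‖ ^ 2 ≤ max G 0 * (1 + ‖x‖ ^ 2) := fun x => by
    have h1 : ‖g x‖ ^ 2 ≤ ‖f x‖ ^ 2 :=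
      pow_le_pow_left₀ (norm_nonneg _) (norm_toEuclideanLin_le_frobenius (f x)) 2
    have h2 := mul_le_mul_of_nonneg_right (le_max_left G 0) (show 0 ≤ 1 + ‖x‖ ^ 2 by positivity)
    linarith [hG x]
  have hint := fun u : Control T m => Control.intervalIntegrable hT.le u
  have hint2 := fun u : Control T m => Control.intervalIntegrable_norm_sq hT.le u
  refine ⟨fun u => ?_, fun x hx ε hε => ?_, fun N u =>
    isSolutionOn_truncatedSignature hT.le (hint u) N⟩
  · obtain ⟨x, hx⟩ := exists_isSolutionOn_of_growth hT.le hG0 hf₀ hg hgr (hint u) (hint2 u) x₀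
    exact ⟨x, hx, fun z hz => eqOn_of_isSolutionOn hT.le hf₀ hg (hint u) (hint u)
      (Eventually.of_forall fun _ _ => rfl) hz hx⟩
  · obtain ⟨ρ, hρ0, hρ⟩ := hK.isBounded.exists_pos_norm_le
    obtain ⟨C₁, hC₁0, hC₁⟩ := exists_norm_sub_le_mul_integral (B := ρ ^ 2) hT.le hG0 hf₀ hg hgr x₀
    obtain ⟨C₂, hC₂0, hC₂⟩ := Control.exists_integral_norm_sub_le (m := m) hT.le
    have henergy : ∀ u ∈ K, ∫ s in (0 : ℝ)..T, ‖u s‖ ^ 2 ≤ ρ ^ 2 := fun u hu => by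
      rw [Control.integral_norm_sq hT.le]
      exact pow_le_pow_left₀ (norm_nonneg _) (hρ u hu) 2
    have hcont : ContinuousOn (fun z : ℝ × Control T m => x z.2 z.1) (Icc 0 T ×ˢ K) := by
      refine continuousOn_prod_of_continuousOn_lipschitzOnWith' _ (C₁ * C₂).toNNReal
        (fun t ht => LipschitzOnWith.of_dist_le_mul fun u hu v hv => ?_) fun u hu => (hx u hu).1
      rw [dist_eq_norm, dist_eq_norm, Real.coe_toNNReal _ (by positivity), mul_assoc]
      exact (hC₁ u v (hint u) (hint v) (hint2 u) (hint2 v) (henergy u hu) (henergy v hv) _ _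
        (hx u hu) (hx v hv) t ht).trans (mul_le_mul_of_nonneg_left (hC₂ u v) hC₁0)
    -- Causality of the output is uniqueness on the shorter interval [0,t]. The accuracy ε/2 keeps
    -- the supremum strictly below ε.
    obtain ⟨N, C, hNC⟩ := exists_matrix_norm_sub_mulVec_lt hT.le hK
      (hc.continuous.comp_continuousOn hcont)
      (fun t ht u hu v hv huv => congrArg c (eqOn_of_isSolutionOn ht.1 hf₀ hg
        (intervalIntegrable_of_mem_Icc (hint u) ht) (intervalIntegrable_of_mem_Icc (hint v) ht)
        huv ((hx u hu).mono ht.2) ((hx v hv).mono ht.2) ⟨ht.1, le_rfl⟩)) (half_pos hε)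
    refine ⟨N, C, lt_of_le_of_lt (b := ENNReal.ofReal (ε / 2)) ?_
      ((ENNReal.ofReal_lt_ofReal_iff hε).2 (half_lt_self hε))⟩
    refine iSup₂_le fun t ht => iSup₂_le fun u hu => ?_
    rw [← ofReal_norm]
    exact ENNReal.ofReal_le_ofReal (hNC t ht u hu)
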